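/- Let $\mathbb F_q$ be a finite field with $q$ elements, with algebraic closure $\overline{\mathbb F}_q$, and let $\Phi:\mathbb P^1\to\mathbb P^2$ be the morphism over $\overline{\mathbb F}_q$ given by $\Phi(s,t)=(s^{q+1},\,s^qt+st^q,\,t^{q+1})$, with image the plane curve $B$ (the Ballico–Hefez curve). For a point $P$ of a projective space, $P^q$ denotes the point obtained by raising its homogeneous coordinates to the $q$-th power. For a morphism $f=(f_0,\dots,f_n)$ from $\mathbb P^1$ to $\mathbb P^n$, represented near $P\in\mathbb P^1$ by regular functions one of which is $1$ and expanded in a local parameter at $P$, with Hasse derivations $D^{(i)}$, the Hermitian $P$-invariant is the lexicographically least $(\varepsilon_0<\dots<\varepsilon_n)$ with $\det\big((D^{(\varepsilon_i)}f_j)(P)\big)_{i,j}\neq 0$; the order-sequence of $f$ is its value for all $P$ in a nonempty open subset. The tangent $\nu$-plane at a nonsingular point $f(P)$ of the image is the linear subspace spanned by the vectors $\big((D^{(\varepsilon_i)}f_0)(P),\dots,(D^{(\varepsilon_i)}f_n)(P)\big)$, $0\le i\le\nu$, where $(\varepsilon_i)$ is the order-sequence. The image is $q$-Frobenius nonclassical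 if for some $\nu<n$ the point $Q^q$ lies on the tangent $\nu$-plane at $Q$ for almost all points $Q$ of the image. For $n=2$, a nonsingular point $Q$ of the plane curve $C=f(\mathbb P^1)$ is an inflection point if the intersection multiplicity of $C$ with its tangent line at $Q$ is greater than $\varepsilon_2$. Let $\operatorname{Sing}B$ and $\operatorname{Flex}B$ be the sets of singular points and of inflection points of $B$. Then: (i) For every $P\in\mathbb P^1$, the differential $d\Phi_P:T_{P,\mathbb P^1}\to T_{\Phi(P),\mathbb P^2}$ is injective. (ii) $\operatorname{Sing}B$ consists of exactly $\frac{q^2-q}{2}$ points, and each of them is an ordinary double point of $B$. (iii) For $P\in\mathbb P^1$, $\Phi(P)\in\operatorname{Sing}B$ if and only if $P\in\mathbb P^1(\mathbb F_{q^2})\setminus\mathbb P^1(\mathbb F_q)$; in this case $\Phi^{-1}(\Phi(P))=\{P,P^q\}$. (iv) The order-sequence of $\Phi$ is $\{0,1,q\}$, and $B$ is $q$-Frobenius nonclassical. (v) For $P\in\mathbb P^1$, $\Phi(P)$ is an inflection point of $B$ if and only if $P\in\mathbb P^1(\mathbb F_q)$. (vi) $B(\mathbb F_q)=\operatorname{Flex}B\cup\operatorname{Sing}B$.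 -/

import Mathlib

open scoped LinearAlgebra.Projectivization

noncomputable section

namespace BallicoHefez

/-! ### Projective spaces over a field and morphisms given by forms -/

/-- The (closed) points of projective space with `n` homogeneous coordinates. -/
abbrev Proj (K : Type*) [Field K] (n : ℕ) : Type _ := ℙ K (Fin n → K)

/-- The `N`-th power map on homogeneous coordinates,
`(x₀ : x₁ : …) ↦ (x₀ ^ N : x₁ ^ N : …)`; for `N = q` this is the `q`-Frobenius map. -/
def powMap {K : Type*} [Field K] {n : ℕ} (N : ℕ) (P : Proj K n) : Proj K n :=
  Projectivization.lift
    (fun v : { v : Fin n → K // v ≠ 0 } =>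
      Projectivization.mk K (fun i => v.1 i ^ N) (by
        obtain ⟨i, hi⟩ := Function.ne_iff.1 v.2
        exact Function.ne_iff.2 ⟨i, pow_ne_zero N hi⟩))
    (by
      rintro ⟨a, ha⟩ ⟨b, hb⟩ t (h : a = t • b)
      rw [Projectivization.mk_eq_mk_iff']
      refine ⟨t ^ N, ?_⟩
      funext i
      simp [h, mul_pow]) P

/-- The points with coordinates in a subfield `E`. -/
def rationalPoints {K : Type*} [Field K] (E : Subfield K) (n : ℕ) : Set (Proj K n) :=
  {P | ∃ (v : Fin n → K) (hv : v ≠ 0), (∀ i, v i ∈ E) ∧ Projectivization.mk K v hv = P}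

/-- For a finite field `F` with `q` elements, the subfield `{x | x ^ (q ^ r) = x}` of `K`, that is,
the field with `q ^ r` elements inside the algebraically closed field `K`. -/
def finiteSubfield (F K : Type*) [Field F] [Fintype F] [Field K] [Algebra F K] (r : ℕ) :
    Subfield K :=
  ((FiniteField.frobeniusAlgHom F K ^ r : K →ₐ[F] K) : K →+* K).eqLocusField (RingHom.id K)

theorem mem_finiteSubfield (F K : Type*) [Field F] [Fintype F] [Field K] [Algebra F K]
    (r : ℕ) (x : K) : x ∈ finiteSubfield F K r ↔ x ^ (Fintype.card F ^ r) = x := by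
  have h : ∀ x : K, (FiniteField.frobeniusAlgHom F K ^ r) x = x ^ (Fintype.card F ^ r) := by
    induction r with
    | zero => intro x; simp
    | succ r ih =>
      intro x
      rw [pow_succ, AlgHom.mul_apply, ih, pow_succ', pow_mul]
      rfl
  rw [← h x]
  rfl

/-- A morphism between projective spaces given by `m` forms of the same degree in `n` variables
without a common zero. -/
structure ProjMap (K : Type*) [Field K] (n m : ℕ) where
  deg : ℕ
  poly : Fin m → MvPolynomial (Fin n) K
  isHomogeneous : ∀ j, (poly j).IsHomogeneous deg
  exists_ne_zero : ∀ v : Fin n → K, v ≠ 0 → ∃ j, MvPolynomial.eval v (poly j) ≠ 0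

namespace ProjMap

variable {K : Type*} [Field K] {n m : ℕ}

/-- The polynomial map on homogeneous coordinates. -/
def lift (f : ProjMap K n m) (v : Fin n → K) : Fin m → K :=
  fun j => MvPolynomial.eval v (f.poly j)

theorem lift_ne_zero (f : ProjMap K n m) {v : Fin n → K} (hv : v ≠ 0) : f.lift v ≠ 0 :=
  Function.ne_iff.2 (f.exists_ne_zero v hv)

theorem lift_smul (f : ProjMap K n m) (t : K) (v : Fin n → K) :
    f.lift (t • v) = t ^ f.deg • f.lift v := by
  funext j
  simp only [lift, Pi.smul_apply, smul_eq_mul]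
  rw [MvPolynomial.eval_eq', MvPolynomial.eval_eq', Finset.mul_sum]
  refine Finset.sum_congr rfl fun d hd => ?_
  have hdeg : ∑ i, d i = f.deg := by
    rw [← (f.isHomogeneous j) (MvPolynomial.mem_support_iff.1 hd), Finsupp.weight_apply,
      Finsupp.sum_fintype _ _ (by simp)]
    simp
  simp only [Pi.smul_apply, smul_eq_mul, mul_pow, Finset.prod_mul_distrib,
    Finset.prod_pow_eq_pow_sum, hdeg]
  ring

/-- The map on points. -/
def toFun (f : ProjMap K n m) (P : Proj K n) : Proj K m :=
  Projectivization.lift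
    (fun v : { v : Fin n → K // v ≠ 0 } => Projectivization.mk K (f.lift v.1) (f.lift_ne_zero v.2))
    (by
      rintro ⟨a, ha⟩ ⟨b, hb⟩ t (h : a = t • b)
      rw [Projectivization.mk_eq_mk_iff']
      exact ⟨t ^ f.deg, by simp only [h, lift_smul]⟩) P

instance : CoeFun (ProjMap K n m) fun _ => Proj K n → Proj K m := ⟨toFun⟩

/-- The Jacobian matrix of the polynomial map on homogeneous coordinates, as a linear map. -/
def jacobian (f : ProjMap K n m) (v : Fin n → K) : (Fin n → K) →ₗ[K] (Fin m → K) :=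
  Matrix.toLin' (Matrix.of fun j i => MvPolynomial.eval v (MvPolynomial.pderiv i (f.poly j)))

theorem jacobian_self (f : ProjMap K n m) (v : Fin n → K) :
    f.jacobian v v = (f.deg : K) • f.lift v := by
  funext j
  have h := congrArg (MvPolynomial.eval v) (f.isHomogeneous j).sum_X_mul_pderiv
  simp only [map_sum, map_mul, MvPolynomial.eval_X, nsmul_eq_mul, map_natCast] at h
  simp only [jacobian, Matrix.toLin'_apply, Matrix.mulVec, dotProduct, Matrix.of_apply,
    Pi.smul_apply, smul_eq_mul, lift, ← h]
  exact Finset.sum_congr rfl fun i _ => mul_comm _ _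

/-- The differential of `f` at the point `[v]`. The tangent space of `ℙ(V)` at `[v]` is `V ⧸ K v`
(it is `Hom(K v, V ⧸ K v)`, and the representative `v` identifies the two), and in these terms the
differential is induced by the Jacobian of the map on homogeneous coordinates. -/
def differential (f : ProjMap K n m) (v : Fin n → K) :
    ((Fin n → K) ⧸ Submodule.span K {v}) →ₗ[K] ((Fin m → K) ⧸ Submodule.span K {f.lift v}) :=
  Submodule.mapQ _ _ (f.jacobian v) (by
    rw [Submodule.span_singleton_le_iff_mem, Submodule.mem_comap, jacobian_self]
    exact Submodule.smul_mem _ _ (Submodule.mem_span_singleton_self _))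

/-- The image of the morphism. -/
def image (f : ProjMap K n m) : Set (Proj K m) := Set.range f.toFun

end ProjMap

/-! ### Plane curves -/

section PlaneCurve

variable {K : Type*} [Field K]

/-- The ideal of a set `C` of points of the plane: the polynomials vanishing at all homogeneous
coordinate vectors of points of `C`. -/
def curveIdeal (C : Set (Proj K 3)) : Ideal (MvPolynomial (Fin 3) K) :=
  MvPolynomial.vanishingIdeal K {v | ∃ hv : v ≠ 0, Projectivization.mk K v hv ∈ C}

/-- The singular points of a plane curve (Jacobian criterion): all the partial derivatives of all
the polynomials in its ideal vanish at the point. -/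
def Sing (C : Set (Proj K 3)) : Set (Proj K 3) :=
  {P | P ∈ C ∧ ∀ F ∈ curveIdeal C, ∀ (v : Fin 3 → K) (hv : v ≠ 0),
    Projectivization.mk K v hv = P → ∀ i, MvPolynomial.eval v (MvPolynomial.pderiv i F) = 0}

/-- The Taylor expansion `F (v + X)` of `F` at `v`. -/
def translate (v : Fin 3 → K) (F : MvPolynomial (Fin 3) K) : MvPolynomial (Fin 3) K :=
  MvPolynomial.aeval (fun i => MvPolynomial.C (v i) + MvPolynomial.X i) F

/-- `P` is an ordinary double point of the plane curve `C`: for the reduced equation `F` of `C`,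
the terms of degree `0` and `1` of the expansion of `F` at `P` vanish, and the term of degree `2`
is a product of two linear forms that are not proportional (the two tangent lines at `P`).
The lowest term of `F (v + X)`, for homogeneous coordinates `v` of `P`, is invariant under
translation by `v`; so it is the lowest term of the expansion of the equation in any affine chart,
pulled back to homogeneous coordinates. -/
def IsOrdinaryDoublePoint (C : Set (Proj K 3)) (P : Proj K 3) : Prop :=
  P ∈ C ∧ ∃ F : MvPolynomial (Fin 3) K, curveIdeal C = Ideal.span {F} ∧
    ∀ (v : Fin 3 → K) (hv : v ≠ 0), Projectivization.mk K v hv = P →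
      MvPolynomial.homogeneousComponent 0 (translate v F) = 0 ∧
      MvPolynomial.homogeneousComponent 1 (translate v F) = 0 ∧
      ∃ L₁ L₂ : MvPolynomial (Fin 3) K, L₁.IsHomogeneous 1 ∧ L₂.IsHomogeneous 1 ∧
        LinearIndependent K ![L₁, L₂] ∧
        MvPolynomial.homogeneousComponent 2 (translate v F) = L₁ * L₂

/-- The expansion `F (v + u w)` of a polynomial along a line, as a power series in `u`. -/
def expand {n : ℕ} (v w : Fin n → K) (F : MvPolynomial (Fin n) K) : PowerSeries K :=
  MvPolynomial.aeval (fun i => PowerSeries.C (v i) + PowerSeries.C (w i) * PowerSeries.X) F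

/-- The intersection multiplicity `i(C.L; P)` of a plane curve `C` with a line `L` (a
two-dimensional space of coordinate vectors) at a point `P` of `L`: the order of vanishing at `P` of
the equation of `C` restricted to `L`. Here `v` represents `P`, `u ↦ v + u w` parametrizes `L` near
`P`, and the order for the equation is the least one for the elements of the ideal; it does not
depend on `v` and `w`. -/
def intersectionMult (C : Set (Proj K 3)) (L : Submodule K (Fin 3 → K)) (P : Proj K 3) : ℕ∞ :=
  sInf {k : ℕ∞ | ∃ (v w : Fin 3 → K) (hv : v ≠ 0), Projectivization.mk K v hv = P ∧
    LinearIndependent K ![v, w] ∧ Submodule.span K {v, w} = L ∧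
    ∃ F ∈ curveIdeal C, k = (expand v w F).order}

end PlaneCurve

/-! ### Order-sequences, Frobenius nonclassical curves, inflection points -/

section Orders

variable {K : Type*} [Field K]

/-- The `i`-th Hasse derivation on power series, `D⁽ⁱ⁾ t ^ k = (k choose i) t ^ (k - i)`. -/
def hasseD (i : ℕ) (g : PowerSeries K) : PowerSeries K :=
  PowerSeries.mk fun k => ((k + i).choose i : K) * PowerSeries.coeff (k + i) g

/-- The data of a local representation of a morphism `f` from the projective line near `P`:
coordinates `v` of `P` and a second vector `w`, so that `u ↦ [v + u w]` is the inverse of a local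
parameter `u` at `P`, and an index `k` such that the `k`-th coordinate of `f P` is not zero. -/
structure LocalRep {m : ℕ} (f : ProjMap K 2 m) (P : Proj K 2) where
  v : Fin 2 → K
  w : Fin 2 → K
  ne_zero : v ≠ 0
  mk_eq : Projectivization.mk K v ne_zero = P
  indep : LinearIndependent K ![v, w]
  k : Fin m
  coord_ne_zero : f.lift v k ≠ 0

namespace LocalRep

variable {m : ℕ} {f : ProjMap K 2 m} {P : Proj K 2}

/-- The tuple of regular functions near `P` that represents `f`, normalized so that its `k`-th
entry is `1`, as power series in the local parameter `u`. -/
def tuple (φ : LocalRep f P) (j : Fin m) : PowerSeries K :=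
  expand φ.v φ.w (f.poly j) * (expand φ.v φ.w (f.poly φ.k))⁻¹

/-- The vector `((D⁽ⁱ⁾ f₀)(P), …, (D⁽ⁱ⁾ fₙ)(P))`. -/
def hasseVec (φ : LocalRep f P) (i : ℕ) : Fin m → K :=
  fun j => PowerSeries.constantCoeff (hasseD i (φ.tuple j))

/-- `det ((D^(ε i) f_j)(P)) ≠ 0`, with `ε` strictly increasing. -/
def Admissible (φ : LocalRep f P) (ε : Fin m → ℕ) : Prop :=
  StrictMono ε ∧ (Matrix.of fun i => φ.hasseVec (ε i)).det ≠ 0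

/-- The space spanned by the vectors `((D^(ε i) f₀)(P), …, (D^(ε i) fₙ)(P))` for `i ≤ ν`. -/
def tangentPlane (φ : LocalRep f P) (ε : Fin m → ℕ) (ν : ℕ) : Submodule K (Fin m → K) :=
  Submodule.span K {x | ∃ i : Fin m, (i : ℕ) ≤ ν ∧ x = φ.hasseVec (ε i)}

end LocalRep

/-- `ε` is the Hermitian `P`-invariant for `f`: the least admissible tuple in the lexicographic
order. -/
def IsHermitianInvariant {m : ℕ} (f : ProjMap K 2 m) (P : Proj K 2) (ε : Fin m → ℕ) : Prop :=
  ∀ φ : LocalRep f P, φ.Admissible ε ∧ ∀ ε' : Fin m → ℕ, φ.Admissible ε' → toLex ε ≤ toLex ε'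

/-- `ε` is the order-sequence for `f`: the Hermitian `P`-invariant at the points `P` of a nonempty
open subset, that is, at all but finitely many points, of the projective line. -/
def IsOrderSequence {m : ℕ} (f : ProjMap K 2 m) (ε : Fin m → ℕ) : Prop :=
  {P : Proj K 2 | ¬ IsHermitianInvariant f P ε}.Finite

/-- The plane curve `C`, the image of `f`, is `q`-Frobenius nonclassical: for some `ν < 2`, and for
almost all nonsingular points `P' = f P` of `C`, the image of `P'` by the `q`-Frobenius map lies on
the tangent `ν`-plane at `P'`. -/
def IsFrobeniusNonclassical (q : ℕ) (f : ProjMap K 2 3) : Prop :=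
  ∃ ε, IsOrderSequence f ε ∧ ∃ ν < 2,
    {P' : Proj K 3 | P' ∈ f.image \ Sing f.image ∧
      ¬ ∀ P : Proj K 2, f P = P' → ∀ φ : LocalRep f P,
        (powMap q P').submodule ≤ φ.tangentPlane ε ν}.Finite

/-- The inflection points of the plane curve `C`, the image of `f`: the nonsingular points
`P' = f P` at which the intersection multiplicity of `C` with the tangent line exceeds `ε₂`. -/
def Flex (f : ProjMap K 2 3) : Set (Proj K 3) :=
  {P' | P' ∈ f.image \ Sing f.image ∧ ∃ ε, IsOrderSequence f ε ∧
    ∀ P : Proj K 2, f P = P' → ∀ φ : LocalRep f P,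
      (ε 2 : ℕ∞) < intersectionMult f.image (φ.tangentPlane ε 1) P'}

end Orders

/-! ### The Ballico–Hefez curve -/

section Curve

variable (F K : Type*) [Field F] [Fintype F] [Field K]

open MvPolynomial in
/-- The morphism `Φ (s, t) = (s ^ (q + 1), s ^ q t + s t ^ q, t ^ (q + 1))`, where `q` is the number
of elements of `F`. -/
def Phi : ProjMap K 2 3 where
  deg := Fintype.card F + 1
  poly := ![X 0 ^ (Fintype.card F + 1),
    X 0 ^ Fintype.card F * X 1 + X 0 * X 1 ^ Fintype.card F,
    X 1 ^ (Fintype.card F + 1)]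
  isHomogeneous := by
    intro j
    fin_cases j
    · exact isHomogeneous_X_pow 0 _
    · refine ((isHomogeneous_X_pow (R := K) (0 : Fin 2) _).mul (isHomogeneous_X K 1)).add ?_
      rw [add_comm (Fintype.card F) 1]
      exact (isHomogeneous_X K 0).mul (isHomogeneous_X_pow 1 _)
    · exact isHomogeneous_X_pow 1 _
  exists_ne_zero := by
    intro v hv
    by_cases h0 : v 0 = 0
    · refine ⟨2, ?_⟩
      have h1 : v 1 ≠ 0 := fun h1 => hv (by
        funext i
        fin_cases i
        · exact h0
        · exact h1)
      simp [h1]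
    · exact ⟨0, by simp [h0]⟩

/-- The Ballico–Hefez curve `B`, the image of `Φ`. -/
def curveB : Set (Proj K 3) := (Phi F K).image

end Curve

end BallicoHefez

end

/-!
# The Ballico–Hefez curve

A quadratic form in two variables over an algebraically closed field is a product of two linear
forms, so `ℙ²` is the symmetric square of `ℙ¹`, by the map `mulForm`. In these terms
`Φ (P) = {P, P ^ q}`, since `(s x + t z) (s ^ q x + t ^ q z)` has the coefficients of `Φ (s, t)`.
Powers of coordinate vectors are taken in each coordinate.
Hence two points have the same image if and only if they are equal or exchanged by the Frobenius map
(`Phi_eq_Phi_iff`).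

The pull-back of the curve to `ℙ¹ × ℙ¹` is the union of the graph of the Frobenius map and its
transpose. The product of the equations of the two is symmetric, so it comes from a form of degree
`q + 1`, namely `X Z ^ q + X ^ q Z - D_{q+1} (Y, X Z)` with the Dickson polynomial `D_{q+1}`
(`curveEq`, `aeval_curveEq`). By the Nullstellensatz it generates the ideal of the curve, as it is
squarefree (`curveIdeal_curveB`).

The local statements follow by pulling back the equation along arcs `(a + u h, b + u h')`
in `ℙ¹ × ℙ¹`. The chain rule (`sum_pderiv_curveEq`) shows that `{P, P ^ q}` is nonsingular if
`P ^ (q ^ 2) ≠ P`, since it lies on just one of the two components. If `P ^ (q ^ 2) = P ≠ P ^ q`,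
then it is a transversal intersection of both, at a point where `mulForm` is étale, and so an
ordinary double point (`isOrdinaryDoublePoint`). If `P ^ q = P`, then `mulForm` is ramified, but a
partial derivative of the explicit equation does not vanish (`Phi_mk_mem_Sing_iff`).

Along `v + u w`, a coordinate vector of `Φ` is
`v · v ^ q + u (w · v ^ q) + u ^ q (v · w ^ q) + u ^ (q + 1) (w · w ^ q)`, so the orders are
`0, 1, q` unless `v` and `v ^ q` are proportional (`isHermitianInvariant`). The tangent line
consists of the multiples of `v ^ q` (`tangentPlane_eq`). It contains `v ^ q · v ^ (q ^ 2)`, the image of the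
point by the Frobenius map, and it meets the curve with multiplicity `q` or, if `v ^ (q ^ 2)` is
proportional to `v`, more (`expand_curveEq`).
-/

noncomputable section

namespace BallicoHefez

open MvPolynomial

/-! ### Products of two linear forms -/

section Forms

variable {R : Type*} [CommRing R]

/-- The determinant of two vectors of the plane. -/
def wedge (a b : Fin 2 → R) : R := a 0 * b 1 - a 1 * b 0

/-- The coefficients of the product of the linear forms `a₀ x + a₁ y` and `b₀ x + b₁ y`. Thus
`mulForm` is the quotient map `ℙ¹ × ℙ¹ → Sym² ℙ¹ = ℙ²` on homogeneous coordinates. -/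
def mulForm (a b : Fin 2 → R) : Fin 3 → R := ![a 0 * b 0, a 0 * b 1 + a 1 * b 0, a 1 * b 1]

@[simp] theorem mulForm_zero (a b : Fin 2 → R) : mulForm a b 0 = a 0 * b 0 := rfl

@[simp] theorem mulForm_one (a b : Fin 2 → R) : mulForm a b 1 = a 0 * b 1 + a 1 * b 0 := rfl

@[simp] theorem mulForm_two (a b : Fin 2 → R) : mulForm a b 2 = a 1 * b 1 := rfl

theorem mulForm_comm (a b : Fin 2 → R) : mulForm a b = mulForm b a := by
  ext i; fin_cases i <;> simp <;> ring

theorem mulForm_add_left (a a' b : Fin 2 → R) :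
    mulForm (a + a') b = mulForm a b + mulForm a' b := by
  ext i; fin_cases i <;> simp <;> ring

theorem mulForm_smul_left (c : R) (a b : Fin 2 → R) : mulForm (c • a) b = c • mulForm a b := by
  ext i; fin_cases i <;> simp <;> ring

theorem mulForm_smul_right (c : R) (a b : Fin 2 → R) : mulForm a (c • b) = c • mulForm a b := by
  ext i; fin_cases i <;> simp <;> ring

theorem mulForm_smul_pow (c : R) (a : Fin 2 → R) (q : ℕ) :
    mulForm (c • a) ((c • a) ^ q) = c ^ (q + 1) • mulForm a (a ^ q) := by
  ext i; fin_cases i <;> simp [mul_pow] <;> ring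

theorem mulForm_pow {q : ℕ} (hq : ∀ x y : R, (x + y) ^ q = x ^ q + y ^ q) (a b : Fin 2 → R) :
    mulForm a b ^ q = mulForm (a ^ q) (b ^ q) := by
  ext i; fin_cases i <;> simp [hq, mul_pow]

end Forms

section FieldForms

variable {K : Type*} [Field K]

theorem exists_smul_of_wedge_eq_zero {a b : Fin 2 → K} (ha : a ≠ 0) (h : wedge a b = 0) :
    ∃ c : K, b = c • a := by
  unfold wedge at h
  by_cases h0 : a 0 = 0
  · have h1 : a 1 ≠ 0 := fun h1 => ha (by ext i; fin_cases i <;> assumption)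
    refine ⟨b 1 / a 1, ?_⟩
    have hb : b 0 = 0 := by simpa [h0, h1] using h
    ext i; fin_cases i <;> simp [h0, hb, h1]
  · refine ⟨b 0 / a 0, ?_⟩
    ext i; fin_cases i
    · simp [h0]
    · simp only [Fin.mk_one, Pi.smul_apply, smul_eq_mul]
      field_simp
      linear_combination h

theorem wedge_smul_right (c : K) (a b : Fin 2 → K) : wedge a (c • b) = c * wedge a b := by
  simp [wedge]; ring

theorem wedge_self (a : Fin 2 → K) : wedge a a = 0 := by
  simp [wedge]; ring

/-- If `a` and `b` are independent, then `(h, h') ↦ a h' + h b` is onto the quadratic forms: the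
quotient map `ℙ¹ × ℙ¹ → Sym² ℙ¹` is étale off the diagonal. -/
theorem exists_eq_mulForm_add {a b : Fin 2 → K} (hab : wedge a b ≠ 0) (y : Fin 3 → K) :
    ∃ h h' : Fin 2 → K, y = mulForm h b + mulForm a h' := by
  -- In the basis `a²`, `a b`, `b²` the form `y` has the coefficients below, divided by `d²`. Those
  -- of `b²` and `a b` go into `h`, that of `a²` into `h'`.
  set d := wedge a b with hd
  refine ⟨(d ^ 2)⁻¹ • ((y 0 * a 1 ^ 2 - y 1 * a 0 * a 1 + y 2 * a 0 ^ 2) • b +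
      (y 1 * (a 0 * b 1 + a 1 * b 0) - 2 * y 0 * a 1 * b 1 - 2 * y 2 * a 0 * b 0) • a),
    (d ^ 2)⁻¹ • ((y 0 * b 1 ^ 2 - y 1 * b 0 * b 1 + y 2 * b 0 ^ 2) • a), ?_⟩
  ext i
  fin_cases i <;> simp <;> field_simp <;> rw [hd] <;> unfold wedge <;> ring

theorem exists_eq_mulForm [IsAlgClosed K] (y : Fin 3 → K) : ∃ a b : Fin 2 → K, y = mulForm a b := by
  by_cases h0 : y 0 = 0
  · exact ⟨![0, 1], ![y 1, y 2], by ext i; fin_cases i <;> simp [h0]⟩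
  · obtain ⟨r, hr⟩ := IsAlgClosed.exists_root
      (Polynomial.C (y 0) * Polynomial.X ^ 2 + Polynomial.C (-y 1) * Polynomial.X +
        Polynomial.C (y 2)) (by rw [Polynomial.degree_quadratic h0]; decide)
    simp only [Polynomial.IsRoot, Polynomial.eval_add, Polynomial.eval_mul, Polynomial.eval_C,
      Polynomial.eval_pow, Polynomial.eval_X] at hr
    refine ⟨![1, r], ![y 0, y 1 - r * y 0], ?_⟩
    ext i; fin_cases i
    · simp
    · simp
    · simp only [Fin.reduceFinMk, mulForm_two, Matrix.cons_val_one, Matrix.cons_val_fin_one]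
      linear_combination hr

end FieldForms

/-! ### The equation of the curve -/

section Equation

variable (K : Type*) [Field K]

/-- The Dickson polynomial `D_n (Y, X Z)`, where `D_n (u + w, u w) = u ^ n + w ^ n`. -/
def powSum : ℕ → MvPolynomial (Fin 3) K
  | 0 => C 2
  | 1 => X 1
  | n + 2 => X 1 * powSum (n + 1) - X 0 * X 2 * powSum n

/-- The equation of the image of `a ↦ mulForm a (a ^ q)`. -/
def curveEq (q : ℕ) : MvPolynomial (Fin 3) K :=
  X 0 * X 2 ^ q + X 0 ^ q * X 2 - powSum K (q + 1)

variable {K}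

theorem aeval_powSum {R : Type*} [CommRing R] [Algebra K R] (a b : Fin 2 → R) : ∀ n : ℕ,
    aeval (mulForm a b) (powSum K n) = (a 0 * b 1) ^ n + (a 1 * b 0) ^ n
  | 0 => by
    simp only [powSum, map_ofNat, pow_zero]
    norm_num
  | 1 => by simp [powSum]
  | n + 2 => by
    simp only [powSum, map_sub, map_mul, aeval_X, aeval_powSum a b n, aeval_powSum a b (n + 1),
      mulForm_zero, mulForm_one, mulForm_two]
    ring

/-- The pull-back of the curve along the quotient map `ℙ¹ × ℙ¹ → Sym² ℙ¹` consists of the graph of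
the Frobenius map and its transpose. -/
theorem aeval_curveEq {R : Type*} [CommRing R] [Algebra K R] (q : ℕ) (a b : Fin 2 → R) :
    aeval (mulForm a b) (curveEq K q) = wedge b (a ^ q) * wedge a (b ^ q) := by
  simp only [curveEq, map_sub, map_add, map_mul, map_pow, aeval_X, aeval_powSum, mulForm_zero,
    mulForm_two, wedge, Pi.pow_apply]
  ring

theorem eval_pderiv_one_powSum (a b : Fin 2 → K) : ∀ n : ℕ,
    wedge a b * eval (mulForm a b) (pderiv 1 (powSum K n)) =
      n * ((a 0 * b 1) ^ n - (a 1 * b 0) ^ n)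
  | 0 => by simp [powSum]
  | 1 => by simp [powSum, wedge]
  | n + 2 => by
    have h0 := eval_pderiv_one_powSum a b n
    have h1 := eval_pderiv_one_powSum a b (n + 1)
    have h2 := aeval_powSum (K := K) a b (n + 1)
    rw [← coe_aeval_eq_eval] at *
    simp only [RingHom.coe_coe] at *
    simp only [powSum, map_sub, map_add, Derivation.leibniz, pderiv_X, smul_eq_mul, map_mul,
      aeval_X, h2, mulForm_zero, mulForm_one, mulForm_two]
    simp only [ne_eq, not_false_eq_true, Pi.single_eq_same, Pi.single_eq_of_ne,
      Fin.reduceEq, map_one, map_zero, zero_ne_one]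
    push_cast at h1 ⊢
    simp only [wedge] at *
    linear_combination (a 0 * b 1 + a 1 * b 0) * h1 - a 0 * b 0 * (a 1 * b 1) * h0

/-- On the diagonal, `u = w` for the parameters `u = a₀ b₁` and `w = a₁ b₀` of the Dickson
polynomial `D_n (u + w, u w)`, and the derivative for `u w` is `- n (n - 1) u ^ (n - 2)`. -/
theorem eval_pderiv_powSum_of_wedge_eq_zero {a b : Fin 2 → K} (hab : wedge a b = 0) {i j : Fin 3}
    (hij : i = 0 ∧ j = 2 ∨ i = 2 ∧ j = 0) : ∀ n : ℕ,
    eval (mulForm a b) (pderiv i (powSum K (n + 2))) =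
      -(mulForm a b j) * ((n + 2) * (n + 1) * (a 0 * b 1) ^ n) := by
  have hab' : a 1 * b 0 = a 0 * b 1 := by simp only [wedge] at hab; linear_combination -hab
  have hX : (X 0 * X 2 : MvPolynomial (Fin 3) K) = X i * X j := by
    rcases hij with ⟨rfl, rfl⟩ | ⟨rfl, rfl⟩ <;> ring
  have hm : mulForm a b i * mulForm a b j = (a 0 * b 1) ^ 2 := by
    rcases hij with ⟨rfl, rfl⟩ | ⟨rfl, rfl⟩ <;> simp only [mulForm_zero, mulForm_two] <;>
      linear_combination a 0 * b 1 * hab'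
  have h1 : pderiv i (X 1 : MvPolynomial (Fin 3) K) = 0 :=
    pderiv_X_of_ne (by rcases hij with ⟨rfl, rfl⟩ | ⟨rfl, rfl⟩ <;> decide)
  have h2 : pderiv i (X j : MvPolynomial (Fin 3) K) = 0 :=
    pderiv_X_of_ne (by rcases hij with ⟨rfl, rfl⟩ | ⟨rfl, rfl⟩ <;> decide)
  have key (n : ℕ) : eval (mulForm a b) (pderiv i (powSum K (n + 2))) =
      (a 0 * b 1 + a 1 * b 0) * eval (mulForm a b) (pderiv i (powSum K (n + 1))) -
        mulForm a b j * (2 * (a 0 * b 1) ^ n) -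
        (a 0 * b 1) ^ 2 * eval (mulForm a b) (pderiv i (powSum K n)) := by
    have h3 : eval (mulForm a b) (powSum K n) = 2 * (a 0 * b 1) ^ n := by
      rw [← aeval_eq_eval]
      simp only [aeval_powSum, hab']
      ring
    rw [powSum, hX]
    simp only [map_sub, map_add, Derivation.leibniz, pderiv_X_self, h1, h2, smul_eq_mul, map_mul,
      eval_X, h3, map_one, map_zero, mulForm_one]
    rw [← hm]
    ring
  intro n
  induction n using Nat.twoStepInduction with
  | zero => rw [key]; simp [powSum, h1]
  | one =>
    rw [key, key]; simp [powSum, h1]; linear_combination (-2 * mulForm a b j) * hab'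
  | more n ih0 ih1 =>
    rw [key, ih0, ih1, hab']; push_cast; ring

theorem eval_pderiv_one_curveEq {a b : Fin 2 → K} {q : ℕ} (hq : (q : K) = 0) :
    wedge a b * eval (mulForm a b) (pderiv 1 (curveEq K q)) =
      (a 1 * b 0) ^ (q + 1) - (a 0 * b 1) ^ (q + 1) := by
  have h := eval_pderiv_one_powSum a b (q + 1)
  have h0 : pderiv (1 : Fin 3) (X 0 : MvPolynomial (Fin 3) K) = 0 := pderiv_X_of_ne (by decide)
  have h2 : pderiv (1 : Fin 3) (X 2 : MvPolynomial (Fin 3) K) = 0 := pderiv_X_of_ne (by decide)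
  simp only [curveEq, map_sub, map_add, Derivation.leibniz, Derivation.leibniz_pow, h0, h2,
    smul_zero, zero_add, zero_sub, map_neg]
  push_cast at h
  rw [hq] at h
  linear_combination -h

/-- At the points of the curve on the conic `Y² = 4 X Z`, the first and the last partial derivative
are `Z ^ q` and `X ^ q`. -/
theorem eval_pderiv_curveEq_of_wedge_eq_zero {a b : Fin 2 → K} (hab : wedge a b = 0) {q : ℕ}
    (hq : (q : K) = 0) (hq2 : 2 ≤ q) {i j : Fin 3} (hij : i = 0 ∧ j = 2 ∨ i = 2 ∧ j = 0) :
    eval (mulForm a b) (pderiv i (curveEq K q)) = mulForm a b j ^ q := by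
  obtain ⟨n, rfl⟩ : ∃ n, q = n + 1 := ⟨q - 1, by omega⟩
  have h := eval_pderiv_powSum_of_wedge_eq_zero hab hij n
  have h2 : pderiv i (X j : MvPolynomial (Fin 3) K) = 0 :=
    pderiv_X_of_ne (by rcases hij with ⟨rfl, rfl⟩ | ⟨rfl, rfl⟩ <;> decide)
  have hX : curveEq K (n + 1) = X i * X j ^ (n + 1) + X i ^ (n + 1) * X j - powSum K (n + 2) := by
    rcases hij with ⟨rfl, rfl⟩ | ⟨rfl, rfl⟩
    · rw [curveEq]
    · rw [curveEq]; ring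
  have hn : (n : K) + 1 = 0 := by exact_mod_cast hq
  have hn' : ((n : MvPolynomial (Fin 3) K) + 1) = 0 := by
    have := congrArg (C (σ := Fin 3)) hn
    simpa using this
  rw [hX]
  simp only [map_sub, map_add, Derivation.leibniz, Derivation.leibniz_pow, pderiv_X_self, h2,
    h, nsmul_eq_mul, smul_eq_mul, map_mul, map_pow, eval_X]
  push_cast
  simp [hn, hn']

end Equation

/-! ### Points and the power map -/

section Points

variable {K : Type*} [Field K]

theorem pow_ne_zero_of_ne_zero {n : ℕ} {v : Fin n → K} (hv : v ≠ 0) (N : ℕ) : v ^ N ≠ 0 := by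
  obtain ⟨i, hi⟩ := Function.ne_iff.1 hv
  exact Function.ne_iff.2 ⟨i, pow_ne_zero N hi⟩

theorem powMap_mk {n : ℕ} (N : ℕ) (v : Fin n → K) (hv : v ≠ 0) :
    powMap N (Projectivization.mk K v hv) =
      Projectivization.mk K (v ^ N) (pow_ne_zero_of_ne_zero hv N) :=
  rfl

theorem powMap_powMap {n : ℕ} (M N : ℕ) (P : Proj K n) :
    powMap M (powMap N P) = powMap (N * M) P := by
  induction P using Projectivization.ind with
  | h v hv => simp only [powMap_mk, pow_mul]

theorem mk_eq_mk_iff_wedge {v w : Fin 2 → K} (hv : v ≠ 0) (hw : w ≠ 0) :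
    Projectivization.mk K v hv = Projectivization.mk K w hw ↔ wedge v w = 0 := by
  rw [eq_comm, Projectivization.mk_eq_mk_iff']
  constructor
  · rintro ⟨a, rfl⟩
    rw [wedge_smul_right, wedge_self, mul_zero]
  · intro h
    obtain ⟨c, rfl⟩ := exists_smul_of_wedge_eq_zero hv h
    exact ⟨c, rfl⟩

theorem mem_rationalPoints_iff (F : Type*) [Field F] [Fintype F] [Algebra F K] {n : ℕ} (r : ℕ)
    (P : Proj K n) :
    P ∈ rationalPoints (finiteSubfield F K r) n ↔ powMap (Fintype.card F ^ r) P = P := by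
  constructor
  · rintro ⟨v, hv, h, rfl⟩
    rw [powMap_mk]
    congr 1
    funext i
    exact (mem_finiteSubfield F K r _).1 (h i)
  · induction P using Projectivization.ind with
    | h v hv =>
      rw [powMap_mk, Projectivization.mk_eq_mk_iff']
      rintro ⟨c, hc⟩
      obtain ⟨i, hi⟩ := Function.ne_iff.1 hv
      have hi : v i ≠ 0 := hi
      have hw : (v i)⁻¹ • v ≠ 0 := smul_ne_zero (inv_ne_zero hi) hv
      refine ⟨(v i)⁻¹ • v, hw, fun j => ?_, ?_⟩
      · rw [mem_finiteSubfield]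
        have h1 := congrFun hc i
        have h2 := congrFun hc j
        simp only [Pi.smul_apply, smul_eq_mul, Pi.pow_apply] at h1 h2 ⊢
        rw [mul_pow, inv_pow, ← h2, ← h1]
        have hc0 : c ≠ 0 := by
          rintro rfl
          exact pow_ne_zero _ hi (by rw [← h1, zero_mul])
        field_simp
      · rw [Projectivization.mk_eq_mk_iff']
        exact ⟨_, rfl⟩

end Points

/-- The linear form on quadratic forms `y₀ x² + y₁ x z + y₂ z²` given by the value at the root of
the linear form with coefficients `b`. Its kernel consists of the multiples of that linear form: it
is the tangent line at `mulForm b b` to the conic of squares. -/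
def rootValue {K : Type*} [Field K] (b : Fin 2 → K) : (Fin 3 → K) →ₗ[K] K where
  toFun y := y 0 * b 1 ^ 2 - y 1 * (b 0 * b 1) + y 2 * b 0 ^ 2
  map_add' x y := by simp only [Pi.add_apply]; ring
  map_smul' c y := by simp only [Pi.smul_apply, smul_eq_mul, RingHom.id_apply]; ring

theorem rootValue_apply {K : Type*} [Field K] (b : Fin 2 → K) (y : Fin 3 → K) :
    rootValue b y = y 0 * b 1 ^ 2 - y 1 * (b 0 * b 1) + y 2 * b 0 ^ 2 := rfl

theorem rootValue_mulForm {K : Type*} [Field K] (a a' b : Fin 2 → K) :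
    rootValue b (mulForm a a') = wedge a b * wedge a' b := by
  simp [rootValue_apply, wedge]; ring

theorem mulForm_ne_zero {K : Type*} [Field K] {a b : Fin 2 → K} (ha : a ≠ 0) (hb : b ≠ 0) :
    mulForm a b ≠ 0 := by
  intro h
  have h0 := congrFun h 0
  have h1 := congrFun h 1
  have h2 := congrFun h 2
  simp only [mulForm_zero, mulForm_one, mulForm_two, Pi.zero_apply, mul_eq_zero] at h0 h1 h2
  have ha' : a 0 = 0 → a 1 = 0 → False := fun h h' => ha (by ext i; fin_cases i <;> assumption)
  have hb' : b 0 = 0 → b 1 = 0 → False := fun h h' => hb (by ext i; fin_cases i <;> assumption)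
  rcases h0 with h0 | h0 <;> rcases h2 with h2 | h2 <;> simp_all

/-! ### The morphism and its fibres -/

section Curve

variable (F K : Type*) [Field F] [Fintype F] [Field K]

theorem Phi_lift (v : Fin 2 → K) : (Phi F K).lift v = mulForm v (v ^ Fintype.card F) := by
  ext j
  fin_cases j <;> simp [ProjMap.lift, Phi] <;> ring

theorem Phi_mk (v : Fin 2 → K) (hv : v ≠ 0) :
    Phi F K (Projectivization.mk K v hv) = Projectivization.mk K (mulForm v (v ^ Fintype.card F))
      (mulForm_ne_zero hv (pow_ne_zero_of_ne_zero hv _)) := by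
  change Projectivization.mk K ((Phi F K).lift v) _ = _
  congr 1
  exact Phi_lift F K v

/-- The morphism `Φ` sends `P` to the unordered pair `{P, P ^ q}`. -/
theorem Phi_eq_Phi_iff (P P' : Proj K 2) :
    Phi F K P = Phi F K P' ↔
      P = P' ∨ (powMap (Fintype.card F) P = P' ∧ powMap (Fintype.card F) P' = P) := by
  induction P using Projectivization.ind with
  | h v hv =>
  induction P' using Projectivization.ind with
  | h w hw =>
  have hvq := pow_ne_zero_of_ne_zero hv (Fintype.card F)
  have hwq := pow_ne_zero_of_ne_zero hw (Fintype.card F)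
  constructor
  · rw [Phi_mk, Phi_mk, Projectivization.mk_eq_mk_iff']
    rintro ⟨c, hc⟩
    rw [powMap_mk, powMap_mk, mk_eq_mk_iff_wedge, mk_eq_mk_iff_wedge, mk_eq_mk_iff_wedge]
    have h1 := congrArg (rootValue w) hc
    have h2 := congrArg (rootValue v) hc
    rw [map_smul, rootValue_mulForm, rootValue_mulForm, wedge_self] at h1 h2
    simp only [zero_mul, mul_zero, smul_eq_mul] at h1 h2
    replace h1 := h1.symm
    have hc0 : c ≠ 0 := by
      rintro rfl
      exact mulForm_ne_zero hv hvq (by rw [← hc, zero_smul])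
    have hvw : wedge w v = 0 → wedge v w = 0 := fun h => by
      unfold wedge at *; linear_combination -h
    rcases mul_eq_zero.1 h1 with h1 | h1
    · exact Or.inl h1
    · rcases mul_eq_zero.1 ((mul_eq_zero.1 h2).resolve_left hc0) with h2 | h2
      · exact Or.inl (hvw h2)
      · exact Or.inr ⟨h1, h2⟩
  · rintro (h | ⟨h1, h2⟩)
    · rw [h]
    · rw [powMap_mk, Projectivization.mk_eq_mk_iff'] at h1 h2
      obtain ⟨c, hc⟩ := h1
      obtain ⟨d, hd⟩ := h2
      rw [Phi_mk, Phi_mk, Projectivization.mk_eq_mk_iff']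
      have hd0 : d ≠ 0 := by rintro rfl; exact hwq (by rw [← hd, zero_smul])
      refine ⟨c * d⁻¹, ?_⟩
      rw [← hc, ← hd, mulForm_smul_right, mulForm_smul_right, mulForm_comm w v, smul_smul,
        mul_assoc, inv_mul_cancel₀ hd0, mul_one]

theorem card_cast_eq_zero [Algebra F K] : (Fintype.card F : K) = 0 := by
  rw [← map_natCast (algebraMap F K), FiniteField.cast_card_eq_zero, map_zero]

variable {K} in
theorem add_pow_card {R : Type*} [CommRing R] [Algebra F R] (x y : R) :
    (x + y) ^ Fintype.card F = x ^ Fintype.card F + y ^ Fintype.card F :=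
  map_add (FiniteField.frobeniusAlgHom F R) x y

variable [IsAlgClosed K]

variable {K} in
/-- The zeros of the equation: the points of the affine cone over the curve, each of them the image
of a vector with no scalar factor, since `K` has all `(q + 1)`-st roots. -/
theorem eval_curveEq_eq_zero_iff (q : ℕ) (y : Fin 3 → K) :
    eval y (curveEq K q) = 0 ↔ ∃ v : Fin 2 → K, y = mulForm v (v ^ q) := by
  rw [← coe_aeval_eq_eval, RingHom.coe_coe]
  constructor
  · intro h
    obtain ⟨a, b, rfl⟩ := exists_eq_mulForm y
    rw [aeval_curveEq] at h
    have key : ∀ a b : Fin 2 → K, wedge a (b ^ q) = 0 → ∃ v, mulForm a b = mulForm v (v ^ q) := by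
      intro a b h
      by_cases hb : b = 0
      · refine ⟨0, ?_⟩
        ext i; fin_cases i <;> simp [hb]
      · obtain ⟨c, rfl⟩ := exists_smul_of_wedge_eq_zero (pow_ne_zero_of_ne_zero hb q) (b := a)
          (by unfold wedge at *; linear_combination -h)
        obtain ⟨m, hm⟩ := IsAlgClosed.exists_pow_nat_eq c (n := q + 1) (by omega)
        refine ⟨m • b, ?_⟩
        rw [mulForm_smul_pow, hm, mulForm_smul_left, mulForm_comm]
    rcases mul_eq_zero.1 h with h | h
    · rw [mulForm_comm]; exact key b a h
    · exact key a b h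
  · rintro ⟨v, rfl⟩
    rw [aeval_curveEq]
    unfold wedge
    simp only [Pi.pow_apply]
    ring

theorem mk_mem_curveB_iff (y : Fin 3 → K) (hy : y ≠ 0) :
    Projectivization.mk K y hy ∈ curveB F K ↔ eval y (curveEq K (Fintype.card F)) = 0 := by
  rw [eval_curveEq_eq_zero_iff]
  constructor
  · rintro ⟨P, hP⟩
    induction P using Projectivization.ind with
    | h v hv =>
      rw [Phi_mk, eq_comm, Projectivization.mk_eq_mk_iff'] at hP
      obtain ⟨c, hc⟩ := hP
      obtain ⟨m, hm⟩ := IsAlgClosed.exists_pow_nat_eq c (n := Fintype.card F + 1) (by omega)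
      exact ⟨m • v, by rw [mulForm_smul_pow, hm, hc]⟩
  · rintro ⟨v, rfl⟩
    have hv : v ≠ 0 := by
      rintro rfl
      apply hy
      ext i; fin_cases i <;> simp
    exact ⟨Projectivization.mk K v hv, Phi_mk F K v hv⟩

/-- Every coordinate vector of `Φ P` is the image of a coordinate vector of `P`. -/
theorem exists_rep {P : Proj K 2} {y : Fin 3 → K} (hy : y ≠ 0)
    (h : Projectivization.mk K y hy = Phi F K P) :
    ∃ (v : Fin 2 → K) (hv : v ≠ 0), Projectivization.mk K v hv = P ∧
      y = mulForm v (v ^ Fintype.card F) := by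
  induction P using Projectivization.ind with
  | h v hv =>
    rw [Phi_mk, Projectivization.mk_eq_mk_iff'] at h
    obtain ⟨c, rfl⟩ := h
    obtain ⟨m, rfl⟩ := IsAlgClosed.exists_pow_nat_eq c (n := Fintype.card F + 1) (by omega)
    have hm : m ≠ 0 := by
      rintro rfl
      exact hy (by simp)
    refine ⟨m • v, smul_ne_zero hm hv, ?_, by rw [mulForm_smul_pow]⟩
    rw [Projectivization.mk_eq_mk_iff']
    exact ⟨m, rfl⟩

end Curve

/-! ### The ideal of the curve -/

section Ideal

variable {K : Type*} [Field K]

theorem totalDegree_powSum_le : ∀ n : ℕ, (powSum K n).totalDegree ≤ n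
  | 0 => by simp [powSum]
  | 1 => by simp [powSum]
  | n + 2 => by
    rw [powSum]
    refine (totalDegree_sub _ _).trans (max_le ?_ ?_)
    · refine (totalDegree_mul _ _).trans ?_
      have := totalDegree_powSum_le (n + 1)
      rw [totalDegree_X]
      omega
    · refine (totalDegree_mul _ _).trans ?_
      have h1 := totalDegree_mul (X 0 : MvPolynomial (Fin 3) K) (X 2)
      have := totalDegree_powSum_le n
      rw [totalDegree_X, totalDegree_X] at h1
      omega

theorem totalDegree_curveEq_le (q : ℕ) : (curveEq K q).totalDegree ≤ q + 1 := by
  refine (totalDegree_sub _ _).trans (max_le ((totalDegree_add _ _).trans (max_le ?_ ?_))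
    (totalDegree_powSum_le _)) <;> refine (totalDegree_mul _ _).trans ?_
  · have := totalDegree_X_pow (R := K) (2 : Fin 3) q
    rw [totalDegree_X]; omega
  · have := totalDegree_X_pow (R := K) (0 : Fin 3) q
    rw [totalDegree_X]; omega

/-- The restriction of polynomials to the affine line `X = 1`, `Z = c`, with coordinate `Y`. -/
def restrictLine (c : K) : MvPolynomial (Fin 3) K →ₐ[K] Polynomial K :=
  aeval ![1, Polynomial.X, Polynomial.C c]

theorem eval_restrictLine (c y : K) (G : MvPolynomial (Fin 3) K) :
    (restrictLine c G).eval y = eval ![1, y, c] G := by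
  rw [restrictLine, ← Polynomial.coe_aeval_eq_eval, ← AlgHom.comp_apply, comp_aeval,
    ← coe_aeval_eq_eval, RingHom.coe_coe]
  congr 2
  ext i; fin_cases i <;> simp

theorem natDegree_restrictLine_le (c : K) (G : MvPolynomial (Fin 3) K) :
    (restrictLine c G).natDegree ≤ G.totalDegree := by
  have := aeval_natDegree_le (n := 1) G le_rfl (![1, Polynomial.X, Polynomial.C c]) (by
    intro i; fin_cases i <;> simp)
  rwa [mul_one] at this

theorem coeff_restrictLine_powSum (c : K) (n : ℕ) :
    (restrictLine c (powSum K (n + 1))).coeff (n + 1) = 1 := by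
  induction n with
  | zero => simp [powSum, restrictLine]
  | succ n ih =>
    have h : (restrictLine c (powSum K n)).coeff (n + 2) = 0 :=
      Polynomial.coeff_eq_zero_of_natDegree_lt (by
        have := (natDegree_restrictLine_le c (powSum K n)).trans (totalDegree_powSum_le n); omega)
    rw [powSum]
    simp only [restrictLine, map_sub, map_mul, aeval_X] at *
    simp [ih, h]

theorem natDegree_restrictLine_curveEq (c : K) (q : ℕ) :
    q + 1 ≤ (restrictLine c (curveEq K q)).natDegree := by
  apply Polynomial.le_natDegree_of_ne_zero
  rw [curveEq, map_sub, Polynomial.coeff_sub, coeff_restrictLine_powSum]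
  have : restrictLine c (X 0 * X 2 ^ q + X 0 ^ q * X 2) = Polynomial.C (c ^ q + c) := by
    simp [restrictLine]
  rw [this, Polynomial.coeff_C]
  simp

variable [IsAlgClosed K]

/-- On a line `X = 1`, `Z = c`, for `Y = u + c / u`, the equation is
`-(u ^ (q + 1) - c) (u ^ (q + 1) - c ^ q) / u ^ (q + 1)`. It has no multiple roots if `c ^ q ≠ c`. -/
theorem restrictLine_no_double_root {q : ℕ} (hq : (q : K) = 0) {c : K}
    (hc : c ^ q ≠ c) (y : K) (h : eval ![1, y, c] (curveEq K q) = 0) :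
    eval ![1, y, c] (pderiv 1 (curveEq K q)) ≠ 0 := by
  obtain ⟨v, hv⟩ := (eval_curveEq_eq_zero_iff q _).1 h
  intro h'
  have key := eval_pderiv_one_curveEq (a := v) (b := v ^ q) hq
  rw [← hv, h', mul_zero] at key
  have h0 : v 0 ^ (q + 1) = 1 := by rw [pow_succ']; exact (congrFun hv 0).symm
  have h2 : v 1 ^ (q + 1) = c := by rw [pow_succ']; exact (congrFun hv 2).symm
  simp only [Pi.pow_apply, mul_pow, ← pow_mul, mul_comm q] at key
  rw [pow_mul, pow_mul, h0, h2, one_pow, mul_one, one_mul] at key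
  exact hc ((sub_eq_zero.1 key.symm).symm)

theorem squarefree_curveEq {q : ℕ} (hq : (q : K) = 0) (hq2 : 2 ≤ q) :
    Squarefree (curveEq K q) := by
  rintro G ⟨H, hGH⟩
  obtain ⟨c, hc⟩ : ∃ c : K, c ^ q ≠ c := by
    obtain ⟨c, hc⟩ := ((Polynomial.X ^ q - Polynomial.X : Polynomial K).rootSet_finite
      K).infinite_compl.nonempty
    refine ⟨c, fun h => hc ?_⟩
    rw [Polynomial.mem_rootSet]
    exact ⟨FiniteField.X_pow_card_sub_X_ne_zero K hq2, by simp [h]⟩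
  have hlow := natDegree_restrictLine_curveEq c q
  have hF0 : restrictLine c (curveEq K q) ≠ 0 := by
    intro h; rw [h] at hlow; simp at hlow
  have hF : curveEq K q ≠ 0 := by
    intro h; rw [h, map_zero] at hF0; exact hF0 rfl
  have hG0 : G ≠ 0 := by rintro rfl; simp [hGH] at hF
  have hH0 : H ≠ 0 := by rintro rfl; simp [hGH] at hF
  -- a root of `G` on the line would be a common zero of the equation and of its derivative
  have hG : (restrictLine c G).natDegree = 0 := by
    by_contra hne
    obtain ⟨y, hy⟩ := IsAlgClosed.exists_root (restrictLine c G) (by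
      rw [Polynomial.degree_eq_natDegree (by rintro h; simp [h] at hne)]
      exact_mod_cast hne)
    rw [Polynomial.IsRoot, eval_restrictLine] at hy
    refine restrictLine_no_double_root hq hc y ?_ ?_
    · simp [hGH, hy]
    · simp [hGH, hy, Derivation.leibniz]
  have hdeg := totalDegree_curveEq_le (K := K) q
  rw [hGH, totalDegree_mul_of_isDomain (mul_ne_zero hG0 hG0) hH0,
    totalDegree_mul_of_isDomain hG0 hG0] at hdeg
  rw [hGH, map_mul, map_mul] at hlow
  have h1 := (Polynomial.natDegree_mul_le (p := restrictLine c G * restrictLine c G)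
    (q := restrictLine c H))
  have h2 := (Polynomial.natDegree_mul_le (p := restrictLine c G) (q := restrictLine c G))
  have h3 := natDegree_restrictLine_le c H
  have hGd : G.totalDegree = 0 := by omega
  rw [totalDegree_eq_zero_iff_eq_C] at hGd
  rw [hGd] at hG0 ⊢
  exact (isUnit_iff_ne_zero.2 fun h => hG0 (by rw [h, C_0])).map C

/-- A polynomial that vanishes at the nonzero vectors of a line through the origin vanishes at the
origin. -/
theorem eval_zero_of_eval_smul {n : ℕ} (G : MvPolynomial (Fin n) K) (y : Fin n → K)
    (h : ∀ t : K, t ≠ 0 → eval (t • y) G = 0) : eval 0 G = 0 := by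
  set p : Polynomial K := aeval (fun i => Polynomial.C (y i) * Polynomial.X) G with hp
  have hpe (t : K) : p.eval t = eval (t • y) G := by
    rw [hp, ← Polynomial.coe_aeval_eq_eval, ← AlgHom.comp_apply, comp_aeval,
      ← coe_aeval_eq_eval, RingHom.coe_coe]
    congr 2
    ext i; simp [mul_comm (y i) t]
  have hp0 : Polynomial.X * p = 0 := Polynomial.funext fun t => by
    rcases eq_or_ne t 0 with rfl | ht
    · simp
    · simp [hpe, h t ht]
  rw [← zero_smul K y, ← hpe, (mul_eq_zero.1 hp0).resolve_left Polynomial.X_ne_zero,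
    Polynomial.eval_zero]

theorem curveIdeal_curveB (F K : Type*) [Field F] [Fintype F] [Field K] [IsAlgClosed K]
    [Algebra F K] : curveIdeal (curveB F K) = Ideal.span {curveEq K (Fintype.card F)} := by
  set q := Fintype.card F with hq
  have hrad : (Ideal.span {curveEq K q}).IsRadical :=
    isRadical_iff_span_singleton.1
      (squarefree_curveEq (card_cast_eq_zero F K) Fintype.one_lt_card).isRadical
  rw [← hrad.radical, ← vanishingIdeal_zeroLocus_eq_radical (K := K)]
  have hz (x : Fin 3 → K) :
      x ∈ zeroLocus K (Ideal.span {curveEq K q}) ↔ eval x (curveEq K q) = 0 := by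
    rw [mem_zeroLocus_iff, ← coe_aeval_eq_eval, RingHom.coe_coe]
    constructor
    · intro h; exact h _ (Ideal.mem_span_singleton_self _)
    · intro h p hp
      obtain ⟨r, rfl⟩ := Ideal.mem_span_singleton.1 hp
      rw [map_mul, h, zero_mul]
  ext G
  rw [curveIdeal, mem_vanishingIdeal_iff, mem_vanishingIdeal_iff]
  constructor
  · intro h x hx
    rw [hz] at hx
    by_cases hx0 : x = 0
    · -- the cone over the curve is not just the origin
      subst hx0
      rw [← RingHom.coe_coe, coe_aeval_eq_eval]
      refine eval_zero_of_eval_smul G (mulForm ![1, 0] ![1, 0]) fun t ht => ?_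
      have hne : t • mulForm ![1, 0] ![(1 : K), 0] ≠ 0 :=
        Function.ne_iff.2 ⟨0, by simpa using ht⟩
      rw [← coe_aeval_eq_eval]
      refine h _ ⟨hne, (mk_mem_curveB_iff F K _ hne).2 ?_⟩
      rw [← mulForm_smul_left, ← coe_aeval_eq_eval, RingHom.coe_coe, aeval_curveEq]
      simp [wedge]
    · exact h x ⟨hx0, (mk_mem_curveB_iff F K x hx0).2 hx⟩
  · rintro h x ⟨hx0, hx⟩
    exact h x ((hz x).2 ((mk_mem_curveB_iff F K x hx0).1 hx))

end Ideal

/-! ### Taylor expansions along arcs -/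

section Taylor

variable {K : Type*} [Field K] {n : ℕ}

/-- The parametrized line `v + u w`, in power series in `u`. -/
def line (v w : Fin n → K) (i : Fin n) : PowerSeries K :=
  PowerSeries.C (v i) + PowerSeries.C (w i) * PowerSeries.X

theorem constantCoeff_aeval (g : Fin n → PowerSeries K) (G : MvPolynomial (Fin n) K) :
    PowerSeries.constantCoeff (aeval g G) =
      eval (fun i => PowerSeries.constantCoeff (g i)) G := by
  induction G using MvPolynomial.induction_on with
  | C a => simp
  | add p q hp hq => simp [hp, hq]
  | mul_X p i hp => simp [hp]

/-- The chain rule at the origin. -/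
theorem coeff_one_aeval (g : Fin n → PowerSeries K) (G : MvPolynomial (Fin n) K) :
    PowerSeries.coeff 1 (aeval g G) = ∑ i, eval (fun i => PowerSeries.constantCoeff (g i))
      (pderiv i G) * PowerSeries.coeff 1 (g i) := by
  induction G using MvPolynomial.induction_on with
  | C a => simp
  | add p q hp hq => simp [hp, hq, add_mul, Finset.sum_add_distrib]
  | mul_X p j hp =>
    have h0 := constantCoeff_aeval g p
    have : Finset.HasAntidiagonal.antidiagonal 1 = {((0 : ℕ), 1), (1, 0)} := rfl
    rw [map_mul, aeval_X, PowerSeries.coeff_mul, this, Finset.sum_insert (by decide),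
      Finset.sum_singleton, hp, PowerSeries.coeff_zero_eq_constantCoeff, h0]
    simp only [Derivation.leibniz, smul_eq_mul, map_add, map_mul, eval_X, add_mul,
      Finset.sum_add_distrib, pderiv_X, Finset.sum_mul]
    congr 1
    · rw [Finset.sum_eq_single j]
      · simp
      · intro b _ hb; simp [hb.symm]
      · simp
    · exact Finset.sum_congr rfl fun i _ => by ring

theorem aeval_mul_of_isHomogeneous {R : Type*} [CommRing R] [Algebra K R] {k : ℕ}
    {G : MvPolynomial (Fin n) K} (hG : G.IsHomogeneous k) (r : R) (x : Fin n → R) :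
    aeval (fun i => r * x i) G = r ^ k * aeval x G := by
  rw [aeval_def, aeval_def, eval₂_eq', eval₂_eq', Finset.mul_sum]
  refine Finset.sum_congr rfl fun d hd => ?_
  have hdeg : ∑ i, d i = k := by
    rw [← hG (mem_support_iff.1 hd), Finsupp.weight_apply, Finsupp.sum_fintype _ _ (by simp)]
    simp
  simp only [mul_pow, Finset.prod_mul_distrib, Finset.prod_pow_eq_pow_sum, hdeg]
  ring

/-- Taylor's formula along an arc through `v`. -/
theorem aeval_eq_sum_homogeneousComponent (v : Fin 3 → K) (x : Fin 3 → PowerSeries K)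
    (G : MvPolynomial (Fin 3) K) :
    aeval (fun i => PowerSeries.C (v i) + PowerSeries.X * x i) G =
      ∑ k ∈ Finset.range ((translate v G).totalDegree + 1),
        PowerSeries.X ^ k * aeval x (homogeneousComponent k (translate v G)) := by
  have h : aeval (fun i => PowerSeries.C (v i) + PowerSeries.X * x i) G =
      aeval (fun i => PowerSeries.X * x i) (translate v G) := by
    rw [translate, ← AlgHom.comp_apply, comp_aeval]
    congr 2
    ext1 i
    simp
  rw [h]
  conv_lhs => rw [← sum_homogeneousComponent (translate v G)]
  rw [map_sum]
  exact Finset.sum_congr rfl fun k _ =>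
    aeval_mul_of_isHomogeneous (homogeneousComponent_isHomogeneous k _) _ _

/-- The first nonzero Taylor coefficient along an arc `v + u x(u)` depends only on the tangent
vector `x(0)`. -/
theorem coeff_aeval_eq_eval_homogeneousComponent (v : Fin 3 → K) (x : Fin 3 → PowerSeries K)
    (G : MvPolynomial (Fin 3) K) (k : ℕ)
    (hk : ∀ j < k, homogeneousComponent j (translate v G) = 0) :
    PowerSeries.coeff k (aeval (fun i => PowerSeries.C (v i) + PowerSeries.X * x i) G) =
      eval (fun i => PowerSeries.constantCoeff (x i)) (homogeneousComponent k (translate v G)) := by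
  rw [aeval_eq_sum_homogeneousComponent, map_sum]
  rw [Finset.sum_eq_single k]
  · rw [PowerSeries.coeff_X_pow_mul', if_pos le_rfl, Nat.sub_self,
      PowerSeries.coeff_zero_eq_constantCoeff, constantCoeff_aeval]
  · intro j _ hj
    rw [PowerSeries.coeff_X_pow_mul']
    split_ifs with h
    · rw [hk j (by omega)]; simp
    · rfl
  · intro h
    rw [homogeneousComponent_eq_zero _ _ (by simpa using h)]; simp

end Taylor

/-! ### Singular points -/

section Frobenius

variable (F : Type*) {K : Type*} [Field F] [Fintype F] [Field K] [Algebra F K]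

local notation "q" => Fintype.card F

theorem mulForm_line (a h b h' : Fin 2 → K) (i : Fin 3) :
    mulForm (line a h) (line b h') i = PowerSeries.C (mulForm a b i) + PowerSeries.X *
      line (mulForm h b + mulForm a h') (mulForm h h') i := by
  fin_cases i <;> simp [line] <;> ring

theorem wedge_line_pow_card (a h b h' : Fin 2 → K) :
    wedge (line a h) (line b h' ^ q) =
      line (n := 1) (fun _ => wedge a (b ^ q)) (fun _ => wedge h (b ^ q)) 0 +
        PowerSeries.X ^ q *
          line (n := 1) (fun _ => wedge a (h' ^ q)) (fun _ => wedge h (h' ^ q)) 0 := by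
  simp only [wedge, line, Pi.pow_apply, add_pow_card, mul_pow, map_sub, map_mul, map_pow]
  ring

theorem coeff_wedge_line_pow_card (a h b h' : Fin 2 → K) :
    PowerSeries.coeff 0 (wedge (line a h) (line b h' ^ q)) = wedge a (b ^ q) ∧
      PowerSeries.coeff 1 (wedge (line a h) (line b h' ^ q)) = wedge h (b ^ q) := by
  have hq : 1 < q := Fintype.one_lt_card
  rw [wedge_line_pow_card]
  constructor <;> rw [map_add, PowerSeries.coeff_X_pow_mul', if_neg (by omega)] <;> simp [line]

/-- The chain rule for the pull-back of the equation to `ℙ¹ × ℙ¹`. -/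
theorem sum_pderiv_curveEq (a h b h' : Fin 2 → K) :
    ∑ i, eval (mulForm a b) (pderiv i (curveEq K q)) * (mulForm h b + mulForm a h') i =
      wedge b (a ^ q) * wedge h (b ^ q) + wedge h' (a ^ q) * wedge a (b ^ q) := by
  have h1 := coeff_one_aeval (mulForm (line a h) (line b h')) (curveEq K q)
  rw [aeval_curveEq] at h1
  have : Finset.HasAntidiagonal.antidiagonal 1 = {((0 : ℕ), 1), (1, 0)} := rfl
  rw [PowerSeries.coeff_mul, this, Finset.sum_insert (by decide), Finset.sum_singleton] at h1
  obtain ⟨h2, h3⟩ := coeff_wedge_line_pow_card F a h b h'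
  obtain ⟨h4, h5⟩ := coeff_wedge_line_pow_card F b h' a h
  rw [h2, h3, h4, h5] at h1
  rw [h1]
  refine Finset.sum_congr rfl fun i _ => ?_
  have hc : (fun i => PowerSeries.constantCoeff (mulForm (line a h) (line b h') i)) =
      mulForm a b := by
    funext i; rw [mulForm_line]; simp
  rw [hc, mulForm_line]
  simp [line]

theorem wedge_pow_card (a b : Fin 2 → K) :
    wedge (a ^ q) (b ^ q) = wedge a b ^ q := by
  have h := map_sub (FiniteField.frobeniusAlgHom F K) (a 0 * b 1) (a 1 * b 0)
  simp only [FiniteField.coe_frobeniusAlgHom] at h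
  unfold wedge
  rw [h]
  simp [mul_pow]

theorem exists_wedge_ne_zero {b : Fin 2 → K} (hb : b ≠ 0) : ∃ h : Fin 2 → K, wedge h b ≠ 0 := by
  by_contra! hc
  refine hb (funext fun i => ?_)
  fin_cases i
  · simpa [wedge] using hc ![0, 1]
  · simpa [wedge] using hc ![1, 0]

theorem rootValue_linearIndependent {b c : Fin 2 → K} (hbc : wedge b c ≠ 0) {s t : K}
    (h : s • rootValue b + t • rootValue c = 0) : s = 0 ∧ t = 0 := by
  have hcb : wedge c b ≠ 0 := fun h => hbc (by unfold wedge at *; linear_combination -h)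
  have h1 := LinearMap.congr_fun h (mulForm b b)
  have h2 := LinearMap.congr_fun h (mulForm c c)
  simp only [LinearMap.add_apply, LinearMap.smul_apply, rootValue_mulForm, wedge_self,
    LinearMap.zero_apply, smul_eq_mul, mul_zero, zero_add, add_zero, mul_eq_zero, hbc, hcb,
    or_false] at h1 h2
  exact ⟨h2, h1⟩

/-- The linear form `rootValue b`, as a polynomial. -/
def rootPoly (b : Fin 2 → K) : MvPolynomial (Fin 3) K :=
  C (b 1 ^ 2) * X 0 - C (b 0 * b 1) * X 1 + C (b 0 ^ 2) * X 2

theorem eval_rootPoly (b : Fin 2 → K) (y : Fin 3 → K) : eval y (rootPoly b) = rootValue b y := by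
  simp only [rootPoly, rootValue_apply, map_add, map_sub, map_mul, eval_C, eval_X]; ring

theorem rootPoly_isHomogeneous (b : Fin 2 → K) : (rootPoly b).IsHomogeneous 1 :=
  (((isHomogeneous_X K 0).C_mul _).sub ((isHomogeneous_X K 1).C_mul _)).add
    ((isHomogeneous_X K 2).C_mul _)

variable [IsAlgClosed K]

theorem mem_Sing_iff (Q : Proj K 3) : Q ∈ Sing (curveB F K) ↔ Q ∈ curveB F K ∧
    ∀ (y : Fin 3 → K) (hy : y ≠ 0), Projectivization.mk K y hy = Q →
      ∀ i, eval y (pderiv i (curveEq K q)) = 0 := by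
  rw [Sing, Set.mem_ofPred_eq, curveIdeal_curveB]
  refine and_congr_right fun hQ => ⟨fun h => h _ (Ideal.mem_span_singleton_self _), ?_⟩
  intro h G hG y hy hyQ i
  obtain ⟨H, rfl⟩ := Ideal.mem_span_singleton.1 hG
  rw [← hyQ, mk_mem_curveB_iff] at hQ
  simp [Derivation.leibniz, hQ, h y hy hyQ i]

theorem Phi_mk_mem_Sing_iff (v : Fin 2 → K) (hv : v ≠ 0) :
    Phi F K (Projectivization.mk K v hv) ∈ Sing (curveB F K) ↔
      wedge v ((v ^ q) ^ q) = 0 ∧ wedge v (v ^ q) ≠ 0 := by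
  have hvq := pow_ne_zero_of_ne_zero hv q
  have hvqq := pow_ne_zero_of_ne_zero hvq q
  rw [mem_Sing_iff]
  constructor
  · rintro ⟨-, h⟩
    replace h := h _ _ (Phi_mk F K v hv).symm
    constructor
    · obtain ⟨h', hh'⟩ := exists_wedge_ne_zero hvq
      have := sum_pderiv_curveEq F v 0 (v ^ q) h'
      simp only [h, zero_mul, Finset.sum_const_zero, wedge_self, zero_add] at this
      exact (mul_eq_zero.1 this.symm).resolve_left hh'
    · intro hw
      have h0 := h 0
      have h2 := h 2
      rw [eval_pderiv_curveEq_of_wedge_eq_zero hw (card_cast_eq_zero F K) Fintype.one_lt_card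
        (Or.inl ⟨rfl, rfl⟩)] at h0
      rw [eval_pderiv_curveEq_of_wedge_eq_zero hw (card_cast_eq_zero F K) Fintype.one_lt_card
        (Or.inr ⟨rfl, rfl⟩)] at h2
      refine hv (funext fun i => ?_)
      fin_cases i
      · simpa [pow_eq_zero_iff] using h2
      · simpa [pow_eq_zero_iff] using h0
  · rintro ⟨h1, h2⟩
    refine ⟨⟨_, rfl⟩, fun y hy hyP i => ?_⟩
    obtain ⟨w, hw, hwP, rfl⟩ := exists_rep F K hy hyP
    have hwq := pow_ne_zero_of_ne_zero hw q
    rw [← mk_eq_mk_iff_wedge hv (by assumption), ← powMap_mk _ _ hvq, ← powMap_mk _ _ hv, ← hwP,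
      powMap_mk, powMap_mk, mk_eq_mk_iff_wedge] at h1
    rw [ne_eq, ← mk_eq_mk_iff_wedge hv (by assumption), ← powMap_mk _ _ hv, ← hwP,
      powMap_mk, mk_eq_mk_iff_wedge] at h2
    obtain ⟨h, h', hh⟩ := exists_eq_mulForm_add h2 (Pi.single i 1)
    have key := sum_pderiv_curveEq F w h (w ^ q) h'
    rw [← hh, wedge_self, h1] at key
    simpa [Pi.single_apply] using key

/-- Near a singular point `v · v ^ q` the quotient map `ℙ¹ × ℙ¹ → Sym² ℙ¹` is étale and the
pull-back of the curve consists of two transversal branches. The tangent lines of their images are the lines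
of the quadratic forms divisible by `v ^ q` and by `v = v ^ (q ^ 2)`. -/
theorem isOrdinaryDoublePoint {Q : Proj K 3} (hQ : Q ∈ Sing (curveB F K)) :
    IsOrdinaryDoublePoint (curveB F K) Q := by
  have hQ' := ((mem_Sing_iff F Q).1 hQ)
  refine ⟨hQ'.1, curveEq K q, curveIdeal_curveB F K, fun y hy hyQ => ?_⟩
  obtain ⟨P, rfl⟩ := hQ'.1
  obtain ⟨w, hw, rfl, rfl⟩ := exists_rep F K hy hyQ
  obtain ⟨h1, h2⟩ := (Phi_mk_mem_Sing_iff F w hw).1 hQ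
  have hgrad := hQ'.2 _ hy hyQ
  have hT (k : ℕ) (z : Fin 3 → K) := coeff_aeval_eq_eval_homogeneousComponent
    (mulForm w (w ^ q)) (fun i => PowerSeries.C (z i)) (curveEq K q) k
  simp only [PowerSeries.constantCoeff_C] at hT
  have hc0 : homogeneousComponent 0 (translate (mulForm w (w ^ q)) (curveEq K q)) = 0 := by
    refine MvPolynomial.funext fun z => ?_
    rw [← hT 0 z (by simp), PowerSeries.coeff_zero_eq_constantCoeff, constantCoeff_aeval]
    simp only [map_add, map_mul, PowerSeries.constantCoeff_C, PowerSeries.constantCoeff_X, zero_mul,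
      add_zero, map_zero]
    exact (eval_curveEq_eq_zero_iff q _).2 ⟨w, rfl⟩
  have hc1 : homogeneousComponent 1 (translate (mulForm w (w ^ q)) (curveEq K q)) = 0 := by
    refine MvPolynomial.funext fun z => ?_
    rw [← hT 1 z (by intro j hj; interval_cases j; exact hc0), coeff_one_aeval]
    simp only [map_add, map_mul, PowerSeries.constantCoeff_C, PowerSeries.constantCoeff_X, zero_mul,
      add_zero, map_zero]
    exact Finset.sum_eq_zero fun i _ => by rw [hgrad i, zero_mul]
  have h3 : wedge (w ^ q) ((w ^ q) ^ q) ≠ 0 := by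
    rw [wedge_pow_card]
    exact pow_ne_zero _ h2
  refine ⟨hc0, hc1, C (wedge w (w ^ q))⁻¹ * rootPoly (w ^ q),
    C (wedge (w ^ q) ((w ^ q) ^ q))⁻¹ * rootPoly ((w ^ q) ^ q),
    (rootPoly_isHomogeneous _).C_mul _, (rootPoly_isHomogeneous _).C_mul _, ?_, ?_⟩
  · rw [LinearIndependent.pair_iff]
    intro s t hst
    have := rootValue_linearIndependent h3 (s := s * (wedge w (w ^ q))⁻¹)
      (t := t * (wedge (w ^ q) ((w ^ q) ^ q))⁻¹) (LinearMap.ext fun y => by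
        have := congrArg (eval y) hst
        simp only [map_add, smul_eval, map_mul, eval_C, eval_rootPoly, map_zero] at this
        simp only [LinearMap.add_apply, LinearMap.smul_apply, smul_eq_mul, LinearMap.zero_apply]
        linear_combination this)
    simpa [h2, h3] using this
  · refine MvPolynomial.funext fun y => ?_
    obtain ⟨h, h', rfl⟩ := exists_eq_mulForm_add h2 y
    have key := coeff_aeval_eq_eval_homogeneousComponent (mulForm w (w ^ q))
      (line (mulForm h (w ^ q) + mulForm w h') (mulForm h h')) (curveEq K q) 2
      (by intro j hj; interval_cases j <;> assumption)
    have hl : (fun i => PowerSeries.constantCoeff (line (mulForm h (w ^ q) + mulForm w h')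
        (mulForm h h') i)) = mulForm h (w ^ q) + mulForm w h' := by
      funext i; simp [line]
    rw [hl] at key
    rw [← key]
    simp only [← mulForm_line]
    obtain ⟨h4, h5⟩ := coeff_wedge_line_pow_card F w h (w ^ q) h'
    obtain ⟨h6, h7⟩ := coeff_wedge_line_pow_card F (w ^ q) h' w h
    have h8 : Finset.HasAntidiagonal.antidiagonal 2 = {((0 : ℕ), 2), (1, 1), (2, 0)} := rfl
    change PowerSeries.coeff 2 (aeval (mulForm (line w h) (line (w ^ q) h')) (curveEq K q)) = _
    rw [aeval_curveEq, PowerSeries.coeff_mul, h8, Finset.sum_insert (by decide),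
      Finset.sum_insert (by decide), Finset.sum_singleton]
    simp only [h4, h5, h6, h7, h1, wedge_self, map_mul, eval_C, eval_rootPoly, map_add,
      rootValue_mulForm]
    field_simp
    ring

end Frobenius

/-! ### Points of the projective line over finite fields -/

section Line

variable {K : Type*} [Field K]

theorem one_vec_ne_zero (x : K) : (![1, x] : Fin 2 → K) ≠ 0 :=
  Function.ne_iff.2 ⟨0, by simp⟩

/-- The point `(1 : x)` of the projective line. -/
def affinePoint (x : K) : Proj K 2 := Projectivization.mk K ![1, x] (one_vec_ne_zero x)

theorem affinePoint_injective : Function.Injective (affinePoint (K := K)) := by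
  intro x y h
  rw [affinePoint, affinePoint, mk_eq_mk_iff_wedge] at h
  simp only [wedge, Matrix.cons_val_zero, Matrix.cons_val_one, Matrix.cons_val_fin_one, one_mul,
    mul_one] at h
  exact (sub_eq_zero.1 h).symm

theorem powMap_affinePoint (N : ℕ) (x : K) : powMap N (affinePoint x) = affinePoint (x ^ N) := by
  rw [affinePoint, affinePoint, powMap_mk, mk_eq_mk_iff_wedge]
  simp [wedge]

theorem exists_eq_affinePoint {v : Fin 2 → K} (hv : v ≠ 0) (h0 : v 0 ≠ 0) :
    ∃ x, Projectivization.mk K v hv = affinePoint x := by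
  refine ⟨v 1 / v 0, ?_⟩
  rw [affinePoint, mk_eq_mk_iff_wedge]
  simp only [wedge, Matrix.cons_val_zero, Matrix.cons_val_one, Matrix.cons_val_fin_one]
  field_simp
  ring

instance [Infinite K] : Infinite (Proj K 2) := Infinite.of_injective _ affinePoint_injective

theorem finite_setOf_pow_eq {N : ℕ} (hN : 1 < N) : {x : K | x ^ N = x}.Finite := by
  refine ((Polynomial.X ^ N - Polynomial.X : Polynomial K).rootSet_finite K).subset fun x hx => ?_
  rw [Polynomial.mem_rootSet]
  exact ⟨FiniteField.X_pow_card_sub_X_ne_zero K hN, by simpa [sub_eq_zero] using hx⟩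

theorem ncard_setOf_pow_eq [IsAlgClosed K] {N : ℕ} (hN : 1 < N) (h0 : (N : K) = 0) :
    {x : K | x ^ N = x}.ncard = N := by
  have hs : {x : K | x ^ N = x} = (Polynomial.X ^ N - Polynomial.X : Polynomial K).rootSet K := by
    ext x
    rw [Polynomial.mem_rootSet]
    simp [FiniteField.X_pow_card_sub_X_ne_zero K hN, sub_eq_zero]
  rw [hs, ← Nat.card_coe_set_eq, Nat.card_eq_fintype_card,
    Polynomial.card_rootSet_eq_natDegree
      (galois_poly_separable (ringChar K) N ((ringChar.spec K N).1 h0))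
      (IsAlgClosed.splits _), FiniteField.X_pow_card_sub_X_natDegree_eq K hN]

theorem finite_setOf_powMap_eq {N : ℕ} (hN : 1 < N) : {P : Proj K 2 | powMap N P = P}.Finite := by
  have h01 : (![0, 1] : Fin 2 → K) ≠ 0 := Function.ne_iff.2 ⟨1, by simp⟩
  refine (((finite_setOf_pow_eq (K := K) hN).image affinePoint).union
    (Set.finite_singleton (Projectivization.mk K ![0, 1] h01))).subset fun P hP => ?_
  induction P using Projectivization.ind with
  | h v hv =>
    by_cases h0 : v 0 = 0
    · refine Or.inr ?_
      rw [Set.mem_singleton_iff, mk_eq_mk_iff_wedge]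
      simp [wedge, h0]
    · obtain ⟨x, hx⟩ := exists_eq_affinePoint hv h0
      rw [hx] at hP ⊢
      refine Or.inl ⟨x, ?_, rfl⟩
      rw [Set.mem_ofPred_eq, powMap_affinePoint] at hP
      exact affinePoint_injective hP

end Line

/-! ### The differential, the number of singular points, rational points -/

section Singularities

variable (F K : Type*) [Field F] [Fintype F] [Field K] [Algebra F K]

local notation "q" => Fintype.card F

theorem jacobian_apply (v w : Fin 2 → K) : (Phi F K).jacobian v w = mulForm w (v ^ q) := by
  have hq' : (Fintype.card F : MvPolynomial (Fin 2) K) = 0 := by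
    simpa using congrArg (C (σ := Fin 2)) (card_cast_eq_zero F K)
  have h01 : pderiv (0 : Fin 2) (X 1 : MvPolynomial (Fin 2) K) = 0 := pderiv_X_of_ne (by decide)
  have h10 : pderiv (1 : Fin 2) (X 0 : MvPolynomial (Fin 2) K) = 0 := pderiv_X_of_ne (by decide)
  ext j
  simp only [ProjMap.jacobian, Matrix.toLin'_apply, Matrix.mulVec, dotProduct, Fin.sum_univ_two,
    Matrix.of_apply, Phi]
  fin_cases j <;> simp [Derivation.leibniz, Derivation.leibniz_pow, h01, h10, hq'] <;> ring

theorem mulForm_left_injective {b : Fin 2 → K} (hb : b ≠ 0) {a a' : Fin 2 → K}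
    (h : mulForm a b = mulForm a' b) : a = a' := by
  by_contra hne
  refine mulForm_ne_zero (sub_ne_zero.2 hne) hb ?_
  rw [sub_eq_add_neg, mulForm_add_left, h, ← neg_one_smul K a', mulForm_smul_left]
  simp

theorem differential_injective {v : Fin 2 → K} (hv : v ≠ 0) :
    Function.Injective ((Phi F K).differential v) := by
  rw [injective_iff_map_eq_zero]
  intro x hx
  obtain ⟨w, rfl⟩ := Submodule.Quotient.mk_surjective _ x
  rw [ProjMap.differential, Submodule.mapQ_apply, Submodule.Quotient.mk_eq_zero,
    Submodule.mem_span_singleton, Phi_lift, jacobian_apply] at hx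
  obtain ⟨c, hc⟩ := hx
  rw [← mulForm_smul_left] at hc
  rw [Submodule.Quotient.mk_eq_zero, Submodule.mem_span_singleton]
  exact ⟨c, mulForm_left_injective K (pow_ne_zero_of_ne_zero hv _) hc⟩

theorem powMap_Phi (P : Proj K 2) : powMap q (Phi F K P) = Phi F K (powMap q P) := by
  induction P using Projectivization.ind with
  | h v hv =>
    rw [Phi_mk, powMap_mk, powMap_mk, Phi_mk]
    congr 1
    exact mulForm_pow (add_pow_card F) _ _

/-- The rational points of the curve are the images of the points over the quadratic extension: a
pair `{P, P ^ q}` is stable under the Frobenius map if and only if `P ^ (q ^ 2) = P`. -/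
theorem powMap_Phi_eq_iff (P : Proj K 2) :
    powMap q (Phi F K P) = Phi F K P ↔ powMap q (powMap q P) = P := by
  rw [powMap_Phi, Phi_eq_Phi_iff]
  constructor
  · rintro (h | h)
    · rw [h, h]
    · exact h.1
  · intro h
    exact Or.inr ⟨h, rfl⟩

variable [IsAlgClosed K]

theorem Phi_mem_Sing_iff (P : Proj K 2) : Phi F K P ∈ Sing (curveB F K) ↔
    powMap q (powMap q P) = P ∧ powMap q P ≠ P := by
  induction P using Projectivization.ind with
  | h v hv =>
    rw [Phi_mk_mem_Sing_iff, powMap_mk, powMap_mk]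
    exact and_congr ((mk_eq_mk_iff_wedge hv _).symm.trans eq_comm)
      (not_congr ((mk_eq_mk_iff_wedge hv _).symm.trans eq_comm))

theorem fiber_of_mem_Sing {P : Proj K 2} (hP : Phi F K P ∈ Sing (curveB F K)) :
    {P' : Proj K 2 | Phi F K P' = Phi F K P} = {P, powMap q P} := by
  rw [Phi_mem_Sing_iff] at hP
  ext P'
  rw [Set.mem_ofPred_eq, Phi_eq_Phi_iff, Set.mem_insert_iff, Set.mem_singleton_iff]
  constructor
  · rintro (h | ⟨-, h⟩)
    · exact Or.inl h
    · exact Or.inr h.symm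
  · rintro (h | rfl)
    · exact Or.inl h
    · exact Or.inr ⟨hP.1, rfl⟩

theorem encard_Sing :
    (Sing (curveB F K)).encard = (((Fintype.card F ^ 2 - Fintype.card F) / 2 : ℕ) : ℕ∞) := by
  classical
  have hq : 1 < q := Fintype.one_lt_card
  have hq2 : 1 < q ^ 2 := Nat.one_lt_pow two_ne_zero hq
  have hq0 := card_cast_eq_zero F K
  set A : Finset K := (finite_setOf_pow_eq (K := K) hq2).toFinset with hA
  set B : Finset K := (finite_setOf_pow_eq (K := K) hq).toFinset with hB
  have hAc : A.card = q ^ 2 := by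
    rw [hA, ← Set.ncard_eq_toFinset_card _ (finite_setOf_pow_eq hq2),
      ncard_setOf_pow_eq hq2 (by push_cast; rw [hq0]; simp)]
  have hBc : B.card = q := by
    rw [hB, ← Set.ncard_eq_toFinset_card _ (finite_setOf_pow_eq hq), ncard_setOf_pow_eq hq hq0]
  have hmA (x : K) : x ∈ A ↔ (x ^ q) ^ q = x := by rw [hA, ← pow_mul, ← sq]; simp
  have hmB (x : K) : x ∈ B ↔ x ^ q = x := by rw [hB]; simp
  have hBA : B ⊆ A := fun x hx => by rw [hmB] at hx; rw [hmA, hx, hx]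
  have hS (x : K) : Phi F K (affinePoint x) ∈ Sing (curveB F K) ↔ x ∈ A \ B := by
    rw [Phi_mem_Sing_iff, powMap_affinePoint, powMap_affinePoint, affinePoint_injective.ne_iff,
      affinePoint_injective.eq_iff, Finset.mem_sdiff, hmA, hmB]
  have himage : Sing (curveB F K) =
      ((A \ B).image fun x => Phi F K (affinePoint x) : Finset (Proj K 3)) := by
    ext Q
    simp only [Finset.coe_image, Set.mem_image, Finset.mem_coe]
    constructor
    · intro hQ
      obtain ⟨P, rfl⟩ := hQ.1
      induction P using Projectivization.ind with
      | h v hv =>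
        have h0 : v 0 ≠ 0 := by
          intro h0
          refine ((Phi_mk_mem_Sing_iff F v hv).1 hQ).2 ?_
          simp [wedge, h0]
        obtain ⟨x, hx⟩ := exists_eq_affinePoint hv h0
        rw [hx] at hQ ⊢
        exact ⟨x, (hS x).1 hQ, rfl⟩
    · rintro ⟨x, hx, rfl⟩
      exact (hS x).2 hx
  have hcount := Finset.card_eq_sum_card_image (fun x => Phi F K (affinePoint x)) (A \ B)
  rw [Finset.sum_const_nat (m := 2)] at hcount
  · rw [Finset.card_sdiff_of_subset hBA, hAc, hBc] at hcount
    rw [himage, Set.encard_coe_eq_coe_finsetCard, hcount, Nat.mul_div_cancel _ two_pos]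
  · intro Q hQ
    obtain ⟨x, hx, rfl⟩ := Finset.mem_image.1 hQ
    have hx' := Finset.mem_sdiff.1 hx
    rw [hmA, hmB] at hx'
    have : (A \ B).filter (fun y => Phi F K (affinePoint y) = Phi F K (affinePoint x)) =
        {x, x ^ q} := by
      ext y
      have hfib := Set.ext_iff.1 (fiber_of_mem_Sing F K ((hS x).2 hx)) (affinePoint y)
      rw [Set.mem_ofPred_eq, Set.mem_insert_iff, Set.mem_singleton_iff, powMap_affinePoint,
        affinePoint_injective.eq_iff, affinePoint_injective.eq_iff] at hfib
      rw [Finset.mem_filter, hfib, Finset.mem_insert, Finset.mem_singleton, and_iff_right_iff_imp]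
      intro h
      rw [← hS, hfib.2 h, hS]
      exact hx
    rw [this, Finset.card_pair (Ne.symm hx'.2)]

end Singularities

/-! ### Orders, tangent lines and inflection points -/

section Orders

variable {F K : Type*} [Field F] [Fintype F] [Field K]

local notation "q" => Fintype.card F

theorem wedge_ne_zero_of_linearIndependent {v w : Fin 2 → K}
    (h : LinearIndependent K ![v, w]) : wedge v w ≠ 0 := by
  intro h0
  have hv : v ≠ 0 := h.ne_zero (0 : Fin 2)
  obtain ⟨c, rfl⟩ := exists_smul_of_wedge_eq_zero hv h0
  have := (LinearIndependent.pair_iff.1 h) c (-1) (by simp)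
  simp at this

theorem linearIndependent_of_wedge_ne_zero {v w : Fin 2 → K}
    (h : wedge v w ≠ 0) : LinearIndependent K ![v, w] := by
  rw [LinearIndependent.pair_iff]
  intro s t hst
  have h0 := congrFun hst 0
  have h1 := congrFun hst 1
  simp only [Pi.add_apply, Pi.smul_apply, smul_eq_mul, Pi.zero_apply] at h0 h1
  constructor
  · refine (mul_eq_zero.1 (?_ : s * wedge v w = 0)).resolve_right h
    unfold wedge; linear_combination w 1 * h0 - w 0 * h1
  · refine (mul_eq_zero.1 (?_ : t * wedge v w = 0)).resolve_right h
    unfold wedge; linear_combination v 0 * h1 - v 1 * h0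

theorem exists_eq_smul_add_smul {v w : Fin 2 → K} (h : wedge v w ≠ 0) (x : Fin 2 → K) :
    ∃ s t : K, x = s • v + t • w := by
  refine ⟨wedge x w / wedge v w, wedge v x / wedge v w, ?_⟩
  ext i
  simp only [Pi.add_apply, Pi.smul_apply, smul_eq_mul]
  field_simp
  unfold wedge
  fin_cases i <;> simp <;> ring

instance {m : ℕ} (f : ProjMap K 2 m) (P : Proj K 2) : Nonempty (LocalRep f P) := by
  induction P using Projectivization.ind with
  | h v hv =>
    obtain ⟨w, hw⟩ := exists_wedge_ne_zero hv
    obtain ⟨k, hk⟩ := f.exists_ne_zero v hv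
    exact ⟨⟨v, w, hv, rfl, linearIndependent_of_wedge_ne_zero
      (fun h => hw (by unfold wedge at *; linear_combination -h)), k, hk⟩⟩

theorem det_mulForm (a a' b b' : Fin 2 → K) :
    (Matrix.of ![mulForm a b, mulForm a' b, mulForm a b']).det =
      -(wedge a a' * wedge a b * wedge b b') := by
  simp [Matrix.det_fin_three, wedge]; ring

variable {P : Proj K 2} (φ : LocalRep (Phi F K) P)

/-- The inverse of the coordinate of `Φ` by which the local representation is divided. -/
def denomInv : PowerSeries K := (expand φ.v φ.w ((Phi F K).poly φ.k))⁻¹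

theorem expand_Phi (v w : Fin 2 → K) (j : Fin 3) :
    expand v w ((Phi F K).poly j) = mulForm (line v w) (line v w ^ q) j := by
  fin_cases j <;> simp [expand, Phi, line] <;> ring

theorem constantCoeff_denomInv : PowerSeries.constantCoeff (denomInv φ) ≠ 0 := by
  rw [denomInv, PowerSeries.constantCoeff_inv, expand, constantCoeff_aeval]
  simpa [ProjMap.lift] using φ.coord_ne_zero

theorem hasseVec_eq [Algebra F K] (i : ℕ) : φ.hasseVec i =
    PowerSeries.coeff i (denomInv φ) • mulForm φ.v (φ.v ^ q) +
    PowerSeries.coeff i (PowerSeries.X * denomInv φ) • mulForm φ.w (φ.v ^ q) +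
    PowerSeries.coeff i (PowerSeries.X ^ q * denomInv φ) • mulForm φ.v (φ.w ^ q) +
    PowerSeries.coeff i (PowerSeries.X ^ (q + 1) * denomInv φ) • mulForm φ.w (φ.w ^ q) := by
  ext j
  have h1 : φ.hasseVec i j = PowerSeries.coeff i (φ.tuple j) := by
    simp [LocalRep.hasseVec, hasseD]
  have h2 : φ.tuple j = PowerSeries.C (mulForm φ.v (φ.v ^ q) j) * denomInv φ +
      PowerSeries.C (mulForm φ.w (φ.v ^ q) j) * (PowerSeries.X * denomInv φ) +
      PowerSeries.C (mulForm φ.v (φ.w ^ q) j) * (PowerSeries.X ^ q * denomInv φ) +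
      PowerSeries.C (mulForm φ.w (φ.w ^ q) j) * (PowerSeries.X ^ (q + 1) * denomInv φ) := by
    rw [LocalRep.tuple, expand_Phi, ← denomInv]
    fin_cases j <;> simp [line, add_pow_card, mul_pow] <;> ring
  rw [h1, h2]
  simp only [map_add, PowerSeries.coeff_C_mul, Pi.add_apply, Pi.smul_apply, smul_eq_mul]
  ring

variable [Algebra F K]

theorem hasseVec_of_lt {i : ℕ} (hi : i < q) : φ.hasseVec i =
    PowerSeries.coeff i (denomInv φ) • mulForm φ.v (φ.v ^ q) +
    PowerSeries.coeff i (PowerSeries.X * denomInv φ) • mulForm φ.w (φ.v ^ q) := by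
  rw [hasseVec_eq, PowerSeries.coeff_X_pow_mul', PowerSeries.coeff_X_pow_mul', if_neg (by omega),
    if_neg (by omega), zero_smul, zero_smul, add_zero, add_zero]

theorem hasseVec_zero : φ.hasseVec 0 =
    PowerSeries.constantCoeff (denomInv φ) • mulForm φ.v (φ.v ^ q) := by
  rw [hasseVec_of_lt φ Fintype.card_pos]
  simp

theorem hasseVec_one : φ.hasseVec 1 =
    PowerSeries.coeff 1 (denomInv φ) • mulForm φ.v (φ.v ^ q) +
    PowerSeries.constantCoeff (denomInv φ) • mulForm φ.w (φ.v ^ q) := by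
  rw [hasseVec_of_lt φ Fintype.one_lt_card, ← pow_one PowerSeries.X, PowerSeries.coeff_X_pow_mul']
  simp

theorem hasseVec_card : φ.hasseVec q =
    PowerSeries.coeff q (denomInv φ) • mulForm φ.v (φ.v ^ q) +
    PowerSeries.coeff q (PowerSeries.X * denomInv φ) • mulForm φ.w (φ.v ^ q) +
    PowerSeries.constantCoeff (denomInv φ) • mulForm φ.v (φ.w ^ q) := by
  rw [hasseVec_eq, PowerSeries.coeff_X_pow_mul', PowerSeries.coeff_X_pow_mul', if_pos le_rfl,
    if_neg (by omega)]
  simp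

/-- Away from the rational points, the orders are `0`, `1` and `q`: below the order `q` the Hasse
derivatives of `v · v ^ q` stay in the space of multiples of `v ^ q`. -/
theorem isHermitianInvariant (hP : powMap q P ≠ P) :
    IsHermitianInvariant (Phi F K) P ![0, 1, q] := by
  intro φ
  have hq : 1 < q := Fintype.one_lt_card
  have hvw := wedge_ne_zero_of_linearIndependent φ.indep
  have hc := constantCoeff_denomInv φ
  have hv : wedge φ.v (φ.v ^ q) ≠ 0 := by
    intro h
    apply hP
    rw [← φ.mk_eq, powMap_mk, eq_comm, mk_eq_mk_iff_wedge]
    exact h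
  refine ⟨⟨?_, ?_⟩, ?_⟩
  · rw [Fin.strictMono_iff_lt_succ]
    intro i
    fin_cases i
    · simp
    · simpa using hq
  · have key := det_mulForm φ.v φ.w (φ.v ^ q) (φ.w ^ q)
    have : (Matrix.of fun i => φ.hasseVec (![0, 1, q] i)).det =
        PowerSeries.constantCoeff (denomInv φ) ^ 3 *
          (Matrix.of ![mulForm φ.v (φ.v ^ q), mulForm φ.w (φ.v ^ q),
            mulForm φ.v (φ.w ^ q)]).det := by
      simp only [Matrix.det_fin_three, Matrix.of_apply, Matrix.cons_val_zero, Matrix.cons_val_one,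
        Matrix.cons_val, hasseVec_zero, hasseVec_one, hasseVec_card, Pi.add_apply, Pi.smul_apply,
        smul_eq_mul]
      ring
    rw [this, key, wedge_pow_card]
    exact mul_ne_zero (pow_ne_zero _ hc)
      (neg_ne_zero.2 (mul_ne_zero (mul_ne_zero hvw hv) (pow_ne_zero _ hvw)))
  · rintro ε' ⟨hmono, hdet⟩
    by_contra hlt
    rw [not_le] at hlt
    obtain ⟨i, hi, hlt⟩ := hlt
    have h01 : ε' 0 < ε' 1 := hmono (by decide)
    fin_cases i
    · simp at hlt
    · have h1 : ε' 1 < 1 := hlt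
      omega
    · have h0 : ε' 0 = 0 := hi 0 (by decide)
      have h1 : ε' 1 = 1 := hi 1 (by decide)
      have h2 : ε' 2 < q := hlt
      apply hdet
      simp only [Matrix.det_fin_three, Matrix.of_apply, h0, h1, hasseVec_zero, hasseVec_one,
        hasseVec_of_lt φ h2, Pi.add_apply, Pi.smul_apply, smul_eq_mul]
      ring

variable (F K) in
theorem isOrderSequence : IsOrderSequence (Phi F K) ![0, 1, q] :=
  (finite_setOf_powMap_eq (K := K) (N := q) Fintype.one_lt_card).subset fun P hP => by
    by_contra h
    exact hP (isHermitianInvariant h)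

theorem IsOrderSequence.unique {m : ℕ} [Infinite K] {f : ProjMap K 2 m} {ε ε' : Fin m → ℕ}
    (h : IsOrderSequence f ε) (h' : IsOrderSequence f ε') : ε = ε' := by
  obtain ⟨P, hP⟩ := (h.union h').infinite_compl.nonempty
  rw [Set.mem_compl_iff, Set.mem_union, not_or] at hP
  obtain ⟨φ⟩ : Nonempty (LocalRep f P) := inferInstance
  obtain ⟨h1, h2⟩ := not_not.1 hP.1 φ
  obtain ⟨h3, h4⟩ := not_not.1 hP.2 φ
  exact toLex.injective (le_antisymm (h2 _ h3) (h4 _ h1))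

/-- The line of the quadratic forms divisible by the linear form `b`. -/
def multiples (b : Fin 2 → K) : Submodule K (Fin 3 → K) where
  carrier := {y | ∃ h, y = mulForm h b}
  add_mem' := by
    rintro _ _ ⟨h, rfl⟩ ⟨h', rfl⟩
    exact ⟨h + h', (mulForm_add_left _ _ _).symm⟩
  zero_mem' := ⟨0, by ext i; fin_cases i <;> simp⟩
  smul_mem' := by
    rintro c _ ⟨h, rfl⟩
    exact ⟨c • h, (mulForm_smul_left _ _ _).symm⟩

/-- The tangent line at `v · v ^ q` consists of the multiples of `v ^ q`. -/
theorem tangentPlane_eq : φ.tangentPlane ![0, 1, q] 1 = multiples (φ.v ^ q) := by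
  have hc := constantCoeff_denomInv φ
  apply le_antisymm
  · rw [LocalRep.tangentPlane, Submodule.span_le]
    rintro _ ⟨i, hi, rfl⟩
    fin_cases i
    · change φ.hasseVec 0 ∈ multiples _
      rw [hasseVec_zero]
      exact Submodule.smul_mem _ _ ⟨_, rfl⟩
    · change φ.hasseVec 1 ∈ multiples _
      rw [hasseVec_one]
      exact Submodule.add_mem _ (Submodule.smul_mem _ _ ⟨_, rfl⟩)
        (Submodule.smul_mem _ _ ⟨_, rfl⟩)
    · simp at hi
  · have h0 : φ.hasseVec 0 ∈ φ.tangentPlane ![0, 1, q] 1 :=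
      Submodule.subset_span ⟨0, by simp, rfl⟩
    have h1 : φ.hasseVec 1 ∈ φ.tangentPlane ![0, 1, q] 1 :=
      Submodule.subset_span ⟨1, by simp, rfl⟩
    rw [hasseVec_zero, Submodule.smul_mem_iff _ hc] at h0
    rw [hasseVec_one, Submodule.add_mem_iff_right _ (Submodule.smul_mem _ _ h0),
      Submodule.smul_mem_iff _ hc] at h1
    rintro _ ⟨h, rfl⟩
    obtain ⟨s, t, rfl⟩ :=
      exists_eq_smul_add_smul (wedge_ne_zero_of_linearIndependent φ.indep) h
    rw [mulForm_add_left, mulForm_smul_left, mulForm_smul_left]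
    exact Submodule.add_mem _ (Submodule.smul_mem _ _ h0) (Submodule.smul_mem _ _ h1)

variable (F K) in
/-- The Frobenius image of `v · v ^ q` is `v ^ q · v ^ (q ^ 2)`, a multiple of `v ^ q`. -/
theorem isFrobeniusNonclassical : IsFrobeniusNonclassical q (Phi F K) := by
  refine ⟨_, isOrderSequence F K, 1, by norm_num, Set.finite_empty.subset ?_⟩
  rintro P' ⟨-, hP'⟩
  refine hP' ?_
  rintro P rfl φ
  have : powMap q (Phi F K P) = powMap q (Phi F K (Projectivization.mk K φ.v φ.ne_zero)) := by
    rw [φ.mk_eq]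
  rw [this, Phi_mk, powMap_mk, Projectivization.submodule_mk, tangentPlane_eq,
    Submodule.span_singleton_le_iff_mem, mulForm_pow (add_pow_card F), mulForm_comm]
  exact ⟨_, rfl⟩

theorem expand_curveEq (u h : Fin 2 → K) :
    expand (mulForm u (u ^ q)) (mulForm h (u ^ q)) (curveEq K q) =
      PowerSeries.X ^ q * (PowerSeries.C (wedge u h ^ q) *
        (PowerSeries.C (wedge u ((u ^ q) ^ q)) +
          PowerSeries.C (wedge h ((u ^ q) ^ q)) * PowerSeries.X)) := by
  have hl : expand (mulForm u (u ^ q)) (mulForm h (u ^ q)) (curveEq K q) =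
      aeval (mulForm (line u h) (line (u ^ q) 0)) (curveEq K q) := by
    rw [expand]
    congr 2
    ext1 i
    fin_cases i <;> simp [line] <;> ring
  have h0 : (0 : Fin 2 → K) ^ q = 0 := by ext i; simp
  have hz (a : Fin 2 → K) : wedge a 0 = 0 := by simp [wedge]
  have hz' (a : Fin 2 → K) : wedge 0 a = 0 := by simp [wedge]
  rw [hl, aeval_curveEq, wedge_line_pow_card, wedge_line_pow_card, wedge_self, h0, hz', hz',
    hz, hz, wedge_pow_card]
  simp [line, mul_assoc]

variable [IsAlgClosed K]

theorem lt_intersectionMult (hP : powMap q P = P) :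
    (q : ℕ∞) < intersectionMult (curveB F K) (φ.tangentPlane ![0, 1, q] 1) (Phi F K P) := by
  have hlt : (q : ℕ∞) < ((q + 1 : ℕ) : ℕ∞) := by exact_mod_cast Nat.lt_succ_self _
  refine hlt.trans_le (le_sInf ?_)
  rintro _ ⟨y, z, hy, hyP, -, hspan, G, hG, rfl⟩
  rw [curveIdeal_curveB] at hG
  obtain ⟨H, rfl⟩ := Ideal.mem_span_singleton.1 hG
  obtain ⟨u, hu, huP, rfl⟩ := exists_rep F K hy hyP
  have hz : z ∈ multiples (φ.v ^ q) := by
    rw [← tangentPlane_eq, ← hspan]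
    exact Submodule.subset_span (by simp)
  obtain ⟨h, rfl⟩ := hz
  have hvP := φ.mk_eq
  replace hvP := hvP.trans huP.symm
  rw [Projectivization.mk_eq_mk_iff'] at hvP
  obtain ⟨c, hc⟩ := hvP
  have hw : wedge u ((u ^ q) ^ q) = 0 := by
    rw [← mk_eq_mk_iff_wedge hu (pow_ne_zero_of_ne_zero (pow_ne_zero_of_ne_zero hu _) _),
      ← powMap_mk _ _ (pow_ne_zero_of_ne_zero hu _), ← powMap_mk _ _ hu, huP, hP, hP]
  have hh : mulForm h (φ.v ^ q) = mulForm (c ^ q • h) (u ^ q) := by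
    rw [← hc, smul_pow, mulForm_smul_right, mulForm_smul_left]
  rw [hh]
  refine PowerSeries.nat_le_order _ _ (PowerSeries.X_pow_dvd_iff.1 ?_)
  have hmul : expand (mulForm u (u ^ q)) (mulForm (c ^ q • h) (u ^ q)) (curveEq K q * H) =
      expand (mulForm u (u ^ q)) (mulForm (c ^ q • h) (u ^ q)) (curveEq K q) *
        expand (mulForm u (u ^ q)) (mulForm (c ^ q • h) (u ^ q)) H := map_mul _ _ _
  rw [hmul, expand_curveEq, hw, pow_succ]
  refine Dvd.dvd.mul_right (mul_dvd_mul_left _ ?_) _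
  rw [map_zero, zero_add, ← mul_assoc]
  exact dvd_mul_left _ _

theorem intersectionMult_le (hP : powMap q (powMap q P) ≠ P) :
    intersectionMult (curveB F K) (φ.tangentPlane ![0, 1, q] 1) (Phi F K P) ≤ q := by
  have hvw := wedge_ne_zero_of_linearIndependent φ.indep
  have hvq := pow_ne_zero_of_ne_zero φ.ne_zero q
  have hmem : (expand (mulForm φ.v (φ.v ^ q)) (mulForm φ.w (φ.v ^ q)) (curveEq K q)).order ∈
      {k : ℕ∞ | ∃ (v w : Fin 3 → K) (hv : v ≠ 0), Projectivization.mk K v hv = Phi F K P ∧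
        LinearIndependent K ![v, w] ∧
        Submodule.span K {v, w} = φ.tangentPlane ![0, 1, q] 1 ∧
        ∃ F' ∈ curveIdeal (curveB F K), k = (expand v w F').order} := by
    refine ⟨_, _, mulForm_ne_zero φ.ne_zero hvq, ?_, ?_, ?_, curveEq K q, ?_, rfl⟩
    · rw [← Phi_mk F K φ.v φ.ne_zero, φ.mk_eq]
    · rw [LinearIndependent.pair_iff]
      intro s t hst
      rw [← mulForm_smul_left, ← mulForm_smul_left, ← mulForm_add_left] at hst
      refine LinearIndependent.pair_iff.1 φ.indep s t ?_
      by_contra hne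
      exact mulForm_ne_zero hne hvq hst
    · rw [tangentPlane_eq]
      apply le_antisymm
      · rw [Submodule.span_le]
        rintro _ (rfl | rfl)
        · exact ⟨_, rfl⟩
        · exact ⟨_, rfl⟩
      · rintro _ ⟨h, rfl⟩
        obtain ⟨s, t, rfl⟩ := exists_eq_smul_add_smul hvw h
        rw [Submodule.mem_span_pair]
        exact ⟨s, t, by rw [mulForm_add_left, mulForm_smul_left, mulForm_smul_left]⟩
    · rw [curveIdeal_curveB]
      exact Ideal.mem_span_singleton_self _
  refine (sInf_le hmem).trans (PowerSeries.order_le _ ?_)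
  have hw : wedge φ.v ((φ.v ^ q) ^ q) ≠ 0 := by
    rw [ne_eq, ← mk_eq_mk_iff_wedge φ.ne_zero (pow_ne_zero_of_ne_zero hvq _),
      ← powMap_mk _ _ hvq, ← powMap_mk _ _ φ.ne_zero, φ.mk_eq]
    exact hP.symm
  rw [expand_curveEq, PowerSeries.coeff_X_pow_mul', if_pos le_rfl, Nat.sub_self]
  simpa [hw] using hvw

variable (P) in
theorem Phi_mem_Flex_iff : Phi F K P ∈ Flex (Phi F K) ↔ powMap q P = P := by
  constructor
  · rintro ⟨⟨-, hns⟩, ε, hε, hflex⟩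
    obtain rfl := hε.unique (isOrderSequence F K)
    obtain ⟨φ⟩ : Nonempty (LocalRep (Phi F K) P) := inferInstance
    by_contra hP
    have hPP : powMap q (powMap q P) ≠ P := fun h => hns ((Phi_mem_Sing_iff F K P).2 ⟨h, hP⟩)
    exact absurd (hflex P rfl φ) (not_lt.2 (intersectionMult_le φ hPP))
  · intro hP
    refine ⟨⟨⟨P, rfl⟩, fun h => ((Phi_mem_Sing_iff F K P).1 h).2 hP⟩, _, isOrderSequence F K, ?_⟩
    intro P' hP' φ
    obtain rfl : P' = P := by
      rcases (Phi_eq_Phi_iff F K P' P).1 hP' with h | ⟨-, h⟩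
      · exact h
      · rw [← h, hP]
    exact lt_intersectionMult φ hP

end Orders

end BallicoHefez

end

open BallicoHefez in
theorem theorem1 (F K : Type*) [Field F] [Fintype F] [Field K] [Algebra F K] [IsAlgClosure F K] :
    -- (i) the differential is injective at every point
    (∀ v : Fin 2 → K, v ≠ 0 → Function.Injective ((Phi F K).differential v)) ∧
    -- (ii) the singularities
    ((Sing (curveB F K)).encard = (((Fintype.card F ^ 2 - Fintype.card F) / 2 : ℕ) : ℕ∞) ∧
      ∀ Q ∈ Sing (curveB F K), IsOrdinaryDoublePoint (curveB F K) Q) ∧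
    -- (iii) their preimages
    (∀ P : Proj K 2,
      (Phi F K P ∈ Sing (curveB F K) ↔
        P ∈ rationalPoints (finiteSubfield F K 2) 2 \ rationalPoints (finiteSubfield F K 1) 2) ∧
      (Phi F K P ∈ Sing (curveB F K) →
        {P' : Proj K 2 | Phi F K P' = Phi F K P} = {P, powMap (Fintype.card F) P})) ∧
    -- (iv) the order-sequence, and Frobenius nonclassicality
    (IsOrderSequence (Phi F K) ![0, 1, Fintype.card F] ∧
      IsFrobeniusNonclassical (Fintype.card F) (Phi F K)) ∧
    -- (v) the inflection points
    (∀ P : Proj K 2,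
      Phi F K P ∈ Flex (Phi F K) ↔ P ∈ rationalPoints (finiteSubfield F K 1) 2) ∧
    -- (vi) the rational points
    curveB F K ∩ rationalPoints (finiteSubfield F K 1) 3 =
      Flex (Phi F K) ∪ Sing (curveB F K) := by
  have : IsAlgClosed K := IsAlgClosure.isAlgClosed F
  refine ⟨fun v hv => differential_injective F K hv, ⟨encard_Sing F K,
    fun Q hQ => isOrdinaryDoublePoint F hQ⟩, fun P => ⟨?_, fiber_of_mem_Sing F K⟩,
    ⟨isOrderSequence F K, isFrobeniusNonclassical F K⟩, fun P => ?_, ?_⟩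
  · rw [Phi_mem_Sing_iff, Set.mem_sdiff, mem_rationalPoints_iff F, mem_rationalPoints_iff F,
      pow_one, powMap_powMap, sq]
  · rw [Phi_mem_Flex_iff, mem_rationalPoints_iff F, pow_one]
  · have key (P : Proj K 2) : Phi F K P ∈ rationalPoints (finiteSubfield F K 1) 3 ↔
        Phi F K P ∈ Flex (Phi F K) ∪ Sing (curveB F K) := by
      rw [mem_rationalPoints_iff F, pow_one, powMap_Phi_eq_iff, Set.mem_union, Phi_mem_Flex_iff,
        Phi_mem_Sing_iff]
      constructor
      · intro h
        by_cases h' : powMap (Fintype.card F) P = P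
        · exact Or.inl h'
        · exact Or.inr ⟨h, h'⟩
      · rintro (h | h)
        · rw [h, h]
        · exact h.1
    ext Q
    constructor
    · rintro ⟨⟨P, rfl⟩, hQ⟩
      exact (key P).1 hQ
    · intro hQ
      obtain ⟨P, rfl⟩ : Q ∈ curveB F K := hQ.elim (fun h => h.1.1) fun h => h.1
      exact ⟨⟨P, rfl⟩, (key P).2 hQ⟩
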